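/- Let $K:[0,1]^2\to\mathbb R$ be given by $K(x,y)=\frac12-\{\frac1{xy}\}$ for $0<x,y\le1$ and $K(x,y)=0$ if $xy=0$, where $\{\alpha\}=\alpha-\lfloor\alpha\rfloor$. For a positive integer $N$ let $K^{\dagger,N}:[0,1]^2\to\mathbb R$ be given by $K^{\dagger,N}(x,y)=\frac12-\bigl\{\frac{N^2}{\lceil Nx\rceil\lceil Ny\rceil}\bigr\}$ for $0<x,y\le1$ and $K^{\dagger,N}(x,y)=0$ if $xy=0$, and let $Z(N)$ be the $N\times N$ matrix with entries $K(\frac mN,\frac nN)$, $1\le m,n\le N$. An eigenvalue of a real symmetric $L^2$ kernel $K^*$ on $[0,1]^2$ is a $\lambda\neq0$ for which there is $\phi:[0,1]\to\mathbb C$ with $0<\int_0^1|\phi|^2<\infty$ and $\phi(x)=\lambda\int_0^1K^*(x,y)\phi(y)\,dy$ for $0\le x\le1$; its index is the dimension over $\mathbb C$ of the space spanned by these $\phi$. List the positive eigenvalues of $K^*$ in increasing order and the negative ones in decreasing order, each repeated as often as its index says. For $m\ge1$ let $\nu^*_{m+}$ (respectively $\nu^*_{m-}$) be the reciprocal of the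 $m$-th positive (respectively negative) eigenvalue in these lists, or $0$ if the list has fewer than $m$ terms. Write $\nu_{m\pm}$ and $\nu^{\dagger,N}_{m\pm}$ for these numbers for $K$ and $K^{\dagger,N}$. **Theorem 2.** Let $m\ge1$ and $N\ge25$ be integers. Then, for either (consistent) choice of sign $\pm$, $$\bigl|\nu_{m\pm}-\nu^{\dagger,N}_{m\pm}\bigr|<\left(2\sqrt{\log N}+\Bigl(1+\frac1{\sqrt N}\Bigr)^{8}\Bigl(\frac49+\frac{23}{30}N^{-1/6}\Bigr)+\frac{\log\log N+9}{\sqrt{\log N}}\right)^{1/2}N^{-1/4}.$$ Moreover $\nu^{\dagger,N}_{m\pm}$, when nonzero, equals $N^{-1}$ times an eigenvalue of $Z(N)$; and for every real $\lambda\ne0$ the index of $\lambda$ as an eigenvalue of $K^{\dagger,N}$ (taken as $0$ if $\lambda$ is not an eigenvalue) equals the dimension over $\mathbb C$ of the kernel of $Z(N)-\frac N\lambda I$ acting on $\mathbb C^N$. -/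

import Mathlib

open MeasureTheory

noncomputable section

namespace WattKernel

/-- The kernel `K(x,y) = 1/2 - {1/(xy)}` for `0 < x, y ≤ 1`, with `K(x,y) = 0` if `xy = 0`.
Kernels are written as functions of two real variables; only their values
on `[0,1] × [0,1]` are ever used. -/
def kernelK (x y : ℝ) : ℝ :=
  if x = 0 ∨ y = 0 then 0 else 1 / 2 - Int.fract (1 / (x * y))

/-- The step kernel `K^{†,N}(x,y) = 1/2 - {N² / (⌈Nx⌉⌈Ny⌉)}` for `0 < x, y ≤ 1`,
with value `0` if `xy = 0`. -/
def stepKernel (N : ℕ) (x y : ℝ) : ℝ :=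
  if x = 0 ∨ y = 0 then 0
  else 1 / 2 - Int.fract ((N : ℝ) ^ 2 / ((⌈(N : ℝ) * x⌉ : ℝ) * (⌈(N : ℝ) * y⌉ : ℝ)))

/-- The `N × N` matrix `Z(N)` with entries `K(m/N, n/N)`, `1 ≤ m, n ≤ N`. -/
def matrixZ (N : ℕ) : Matrix (Fin N) (Fin N) ℝ :=
  Matrix.of fun i j => kernelK (((i : ℕ) + 1 : ℝ) / N) (((j : ℕ) + 1 : ℝ) / N)

/-- The space of all square integrable `φ : [0,1] → ℂ` that satisfy
`φ(x) = l ∫₀¹ k(x,y) φ(y) dy` at every point `x` of `[0,1]`. Its nonzero elements are exactly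
the eigenfunctions of `k` for the eigenvalue `l` (a solution that vanishes almost everywhere
vanishes everywhere; for `l = 0` there is only the zero solution). -/
def kernelEigenspace (k : ℝ → ℝ → ℝ) (l : ℝ) : Submodule ℂ (unitInterval → ℂ) where
  carrier := {φ | MemLp φ 2 volume ∧ ∀ x : unitInterval,
    Integrable (fun y : unitInterval => (k x y : ℂ) * φ y) volume ∧
      φ x = (l : ℂ) * ∫ y : unitInterval, (k x y : ℂ) * φ y}
  zero_mem' := by
    refine ⟨MemLp.zero, fun x => ⟨?_, ?_⟩⟩ <;> simp
  add_mem' := by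
    rintro φ ψ ⟨hφ, hφ'⟩ ⟨hψ, hψ'⟩
    refine ⟨hφ.add hψ, fun x => ⟨?_, ?_⟩⟩
    · simp only [Pi.add_apply, mul_add]
      exact (hφ' x).1.add (hψ' x).1
    · simp only [Pi.add_apply, mul_add]
      rw [integral_add (hφ' x).1 (hψ' x).1, mul_add, ← (hφ' x).2, ← (hψ' x).2]
  smul_mem' := by
    rintro c φ ⟨hφ, hφ'⟩
    refine ⟨hφ.const_smul c, fun x => ⟨?_, ?_⟩⟩
    · simpa [mul_left_comm] using (hφ' x).1.const_mul c
    · simp only [Pi.smul_apply, smul_eq_mul, mul_left_comm _ c]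
      rw [integral_const_mul, mul_left_comm, ← (hφ' x).2]

/-- The index (multiplicity) of `l` as an eigenvalue of the kernel `k`: the dimension over `ℂ`
of the space spanned by its eigenfunctions. It is positive precisely when `l` is an eigenvalue
(these dimensions are finite for real symmetric `L²` kernels). -/
def index (k : ℝ → ℝ → ℝ) (l : ℝ) : ℕ :=
  Module.finrank ℂ (kernelEigenspace k l)

/-- The number of eigenvalues of `k` in the set `S`, each counted as many times as
its index. -/
def eigenvalueCount (k : ℝ → ℝ → ℝ) (S : Set ℝ) : ℕ∞ :=
  Set.encard {p : ℝ × ℕ | p.1 ∈ S ∧ p.2 < index k p.1}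

open Classical in
/-- The `j`-th reciprocal positive eigenvalue `ν_{j+}` of `k` (`j ≥ 1`): the reciprocal of the
`j`-th smallest positive eigenvalue, counted with multiplicity, that is of the least `t > 0` with
at least `j` eigenvalues in `(0,t]`; zero if `k` has fewer than `j` positive eigenvalues. -/
def nuPos (k : ℝ → ℝ → ℝ) (j : ℕ) : ℝ :=
  if (j : ℕ∞) ≤ eigenvalueCount k (Set.Ioi 0) then
    1 / sInf {t : ℝ | 0 < t ∧ (j : ℕ∞) ≤ eigenvalueCount k (Set.Ioc 0 t)}
  else 0

open Classical in
/-- The `j`-th reciprocal negative eigenvalue `ν_{j-}` of `k` (`j ≥ 1`): the reciprocal of the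
`j`-th largest negative eigenvalue, counted with multiplicity, that is of the greatest `t < 0` with
at least `j` eigenvalues in `[t,0)`; zero if `k` has fewer than `j` negative eigenvalues. -/
def nuNeg (k : ℝ → ℝ → ℝ) (j : ℕ) : ℝ :=
  if (j : ℕ∞) ≤ eigenvalueCount k (Set.Iio 0) then
    1 / sSup {t : ℝ | t < 0 ∧ (j : ℕ∞) ≤ eigenvalueCount k (Set.Ico t 0)}
  else 0

/-- The quantity `2√(log N) + (1 + 1/√N)⁸ (4/9 + (23/30) N^{-1/6}) + (log log N + 9)/√(log N)`. -/
def bracket (N : ℕ) : ℝ :=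
  2 * √(Real.log N) + (1 + 1 / √(N : ℝ)) ^ 8 * (4 / 9 + 23 / 30 * (N : ℝ) ^ (-(1 / 6) : ℝ))
    + (Real.log (Real.log N) + 9) / √(Real.log N)

end WattKernel

end

open MeasureTheory Module.End

namespace WattKernel

/-! ### Pointwise bounds for the squared difference of the kernels. -/

section

/-! By Weyl's inequality, the reciprocal eigenvalues of two compact self-adjoint operators, ordered
by size with each sign apart, differ by at most the operator norm of the difference, hence by at
most its Hilbert–Schmidt norm. The theorem thus reduces to bounding the double integral of `(K -
K†)²` by something below `bracket N / √N`.

For that integral, `K†` is `K` with both variables rounded up to the grid of mesh `1/N`. Rounding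
moves `1/(xy)` down. If no integer is passed, the kernels differ by exactly that small move;
otherwise the squared difference is at most 1, hence at most the number of integers passed
(`sq_fract_sub_fract_le`). In one variable that number telescopes: its integral is at most the mesh
times the value of `1/(cy)` at the left end (`lintegral_floorDrop_le`). This works on the region `x,
y > η`, `xy > δ`. On the complement the trivial bound 1 is used, so the cost is the area. Taking `η
= 2/√N` and `δ = 2/√(N log N)` gives a total of order `√(log N / N)`
(`lintegral_sq_kernel_sub_le_hsBound`), and `hsBound_lt` compares the constants.

On the spectral side, the `j`-th positive reciprocal eigenvalue is characterised, as in
Courant–Fischer, by `j`-dimensional subspaces on which the quadratic form is at least `t ‖v‖²`. That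
property survives a perturbation of norm `ε` with `t` replaced by `t - ε` (`nuPos_le_add`). The step
kernel has finite rank, so `K`, a norm limit of step kernels, is compact. Negative eigenvalues
follow by applying all this to `-K`.

For the matrix statements, an eigenfunction of the step kernel is constant on each cell, and its
vector of values is an eigenvector of `Z(N)`; the factor `N` is the inverse of the cell length
(`index_stepKernel`). -/

/-- With equal floors the difference is `g - f`. Otherwise the floors differ by at least 1, which
already dominates the square of a difference of two fractional parts. -/
lemma sq_fract_sub_fract_le {f g θ : ℝ} (hgf : g ≤ f) (hθ : f - g ≤ θ) :
    ((1 / 2 - Int.fract f) - (1 / 2 - Int.fract g)) ^ 2 ≤ ((⌊f⌋ : ℝ) - ⌊g⌋) + θ ^ 2 := by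
  have h1 := Int.fract_lt_one f
  have h2 := Int.fract_nonneg f
  have h3 := Int.fract_lt_one g
  have h4 := Int.fract_nonneg g
  have hfl : ⌊g⌋ ≤ ⌊f⌋ := Int.floor_le_floor hgf
  rcases hfl.eq_or_lt with h | h
  · have : (1 / 2 - Int.fract f) - (1 / 2 - Int.fract g) = g - f := by
      rw [Int.fract, Int.fract, h]; ring
    rw [this, h]
    nlinarith
  · have : (1 : ℝ) ≤ (⌊f⌋ : ℝ) - ⌊g⌋ := by
      have : ⌊g⌋ + 1 ≤ ⌊f⌋ := h
      have : ((⌊g⌋ + 1 : ℤ) : ℝ) ≤ ⌊f⌋ := by exact_mod_cast this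
      push_cast at this
      linarith
    nlinarith [sq_nonneg θ]

lemma sq_fract_sub_fract_le_one (f g : ℝ) :
    ((1 / 2 - Int.fract f) - (1 / 2 - Int.fract g)) ^ 2 ≤ 1 := by
  have h1 := Int.fract_lt_one f
  have h2 := Int.fract_nonneg f
  have h3 := Int.fract_lt_one g
  have h4 := Int.fract_nonneg g
  nlinarith

/-- The right side is the first-order term at `(x, y)`; it suffices because `1/(xy)` is convex on
the open quadrant and so lies above its tangent plane. -/
lemma inv_mul_sub_inv_mul_le {x y a b h : ℝ} (hx : 0 < x) (hy : 0 < y) (hxa : x ≤ a) (hyb : y ≤ b)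
    (ha : a ≤ x + h) (hb : b ≤ y + h) :
    1 / (x * y) - 1 / (a * b) ≤ h * (1 / (x ^ 2 * y) + 1 / (x * y ^ 2)) := by
  have hh : 0 ≤ h := by linarith
  have hab : a * b ≤ (x + h) * (y + h) := by gcongr; linarith
  have hab0 : 0 < a * b := mul_pos (by linarith) (by linarith)
  have h1 : 1 / ((x + h) * (y + h)) ≤ 1 / (a * b) := one_div_le_one_div_of_le hab0 hab
  have h2 : 1 / (x * y) - 1 / ((x + h) * (y + h))
      ≤ h * (1 / (x ^ 2 * y) + 1 / (x * y ^ 2)) := by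
    have e1 : 1 / (x * y) - 1 / ((x + h) * (y + h))
      = (h * (x + y) + h ^ 2) / (x * y * ((x + h) * (y + h))) := by
      field_simp; ring
    have e2 : h * (1 / (x ^ 2 * y) + 1 / (x * y ^ 2)) = (h * (x + y)) / (x * y * (x * y)) := by
      field_simp; ring
    rw [e1, e2, div_le_div_iff₀ (by positivity) (by positivity)]
    have : 0 ≤ x * y * (h ^ 2 * (x ^ 2 + x * y + y ^ 2) + h ^ 3 * (x + y)) := by positivity
    nlinarith
  linarith

/-- The right endpoint of the cell of length `1 / N` that contains `x`. -/
noncomputable def roundUp (N : ℕ) (x : ℝ) : ℝ := (⌈(N : ℝ) * x⌉ : ℝ) / N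

variable {N : ℕ}

lemma le_roundUp (hN : 0 < N) (x : ℝ) : x ≤ roundUp N x := by
  have : (0 : ℝ) < N := by exact_mod_cast hN
  rw [roundUp, le_div_iff₀ this, mul_comm]
  exact Int.le_ceil _

lemma roundUp_le (hN : 0 < N) (x : ℝ) : roundUp N x ≤ x + 1 / N := by
  have h : (0 : ℝ) < N := by exact_mod_cast hN
  rw [roundUp, div_le_iff₀ h, add_mul, one_div, inv_mul_cancel₀ h.ne', mul_comm x]
  exact (Int.ceil_lt_add_one _).le

lemma measurable_roundUp : Measurable (roundUp N) := by
  unfold roundUp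
  have : Measurable fun x : ℝ => ⌈(N : ℝ) * x⌉ := by fun_prop
  exact (measurable_from_top.comp this).div_const _

lemma stepKernel_eq (hN : 0 < N) {x y : ℝ} (hx : x ≠ 0) (hy : y ≠ 0) :
    stepKernel N x y = 1 / 2 - Int.fract (1 / (roundUp N x * roundUp N y)) := by
  have h : (N : ℝ) ≠ 0 := by exact_mod_cast hN.ne'
  rw [stepKernel, if_neg (by tauto), roundUp, roundUp]
  congr 2
  rw [div_mul_div_comm, one_div_div, sq]

lemma kernelK_eq {x y : ℝ} (hx : x ≠ 0) (hy : y ≠ 0) :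
    kernelK x y = 1 / 2 - Int.fract (1 / (x * y)) := by
  rw [kernelK, if_neg (by tauto)]

lemma abs_half_sub_fract_le (f : ℝ) : |1 / 2 - Int.fract f| ≤ 1 / 2 := by
  rw [abs_le]
  constructor <;> linarith [Int.fract_lt_one f, Int.fract_nonneg f]

lemma abs_kernelK_le (x y : ℝ) : |kernelK x y| ≤ 1 / 2 := by
  unfold kernelK
  split_ifs
  · norm_num
  · exact abs_half_sub_fract_le _

lemma abs_stepKernel_le (x y : ℝ) : |stepKernel N x y| ≤ 1 / 2 := by
  unfold stepKernel
  split_ifs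
  · norm_num
  · exact abs_half_sub_fract_le _

lemma kernelK_comm (x y : ℝ) : kernelK x y = kernelK y x := by
  simp only [kernelK, or_comm, mul_comm]

lemma stepKernel_comm (x y : ℝ) : stepKernel N x y = stepKernel N y x := by
  simp only [stepKernel, or_comm, mul_comm]

lemma measurable_kernelK : Measurable (Function.uncurry kernelK) := by
  unfold Function.uncurry kernelK
  refine Measurable.ite ?_ measurable_const ?_
  · exact (measurable_fst (measurableSet_singleton 0)).union
      (measurable_snd (measurableSet_singleton 0))
  · exact measurable_const.sub (by fun_prop)

lemma measurable_stepKernel : Measurable (Function.uncurry (stepKernel N)) := by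
  unfold Function.uncurry stepKernel
  refine Measurable.ite ?_ measurable_const ?_
  · exact (measurable_fst (measurableSet_singleton 0)).union
      (measurable_snd (measurableSet_singleton 0))
  · have h1 : Measurable fun p : ℝ × ℝ => ((⌈(N : ℝ) * p.1⌉ : ℤ) : ℝ) :=
      measurable_from_top.comp (by fun_prop : Measurable fun p : ℝ × ℝ => ⌈(N : ℝ) * p.1⌉)
    have h2 : Measurable fun p : ℝ × ℝ => ((⌈(N : ℝ) * p.2⌉ : ℤ) : ℝ) :=
      measurable_from_top.comp (by fun_prop : Measurable fun p : ℝ × ℝ => ⌈(N : ℝ) * p.2⌉)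
    exact measurable_const.sub (measurable_fract.comp (measurable_const.div (h1.mul h2)))

lemma sq_kernel_sub_le_one (hN : 0 < N) {x y : ℝ} (hx : 0 < x) (hy : 0 < y) :
    (kernelK x y - stepKernel N x y) ^ 2 ≤ 1 := by
  rw [kernelK_eq hx.ne' hy.ne', stepKernel_eq hN hx.ne' hy.ne']
  exact sq_fract_sub_fract_le_one _ _

/-- The number of integers that `1 / (c * y)` passes when `y` is rounded up. -/
noncomputable def floorDrop (N : ℕ) (c y : ℝ) : ℝ :=
  (⌊1 / (c * y)⌋ : ℝ) - ⌊1 / (c * roundUp N y)⌋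

/-- The floor difference telescopes through the intermediate point `(x, roundUp N y)`, so each
summand rounds one variable with the other fixed. The square of the first-order term splits by `(A +
B)² ≤ 2A² + 2B²`. -/
lemma sq_kernel_sub_le (hN : 0 < N) {x y : ℝ} (hx : 0 < x) (hy : 0 < y) :
    (kernelK x y - stepKernel N x y) ^ 2 ≤
      (floorDrop N x y + 2 * (1 / N) ^ 2 * (1 / (x ^ 4 * y ^ 2)))
      + (floorDrop N (roundUp N y) x + 2 * (1 / N) ^ 2 * (1 / (y ^ 4 * x ^ 2))) := by
  have hxa := le_roundUp hN x
  have hyb := le_roundUp hN y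
  rw [kernelK_eq hx.ne' hy.ne', stepKernel_eq hN hx.ne' hy.ne']
  refine (sq_fract_sub_fract_le ?_ (inv_mul_sub_inv_mul_le hx hy hxa hyb (roundUp_le hN x)
    (roundUp_le hN y))).trans ?_
  · apply one_div_le_one_div_of_le (mul_pos hx hy)
    exact mul_le_mul hxa hyb hy.le (hx.le.trans hxa)
  · have h1 : (1 / (x ^ 2 * y) + 1 / (x * y ^ 2)) ^ 2
        ≤ 2 * (1 / (x ^ 4 * y ^ 2)) + 2 * (1 / (y ^ 4 * x ^ 2)) := by
      have e1 : 1 / (x ^ 4 * y ^ 2) = (1 / (x ^ 2 * y)) ^ 2 := by field_simp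
      have e2 : 1 / (y ^ 4 * x ^ 2) = (1 / (x * y ^ 2)) ^ 2 := by field_simp
      rw [e1, e2]
      nlinarith [sq_nonneg (1 / (x ^ 2 * y) - 1 / (x * y ^ 2))]
    rw [mul_pow, floorDrop, floorDrop, mul_comm (roundUp N y) x,
      mul_comm (roundUp N y) (roundUp N x)]
    have h2 := mul_le_mul_of_nonneg_left h1 (sq_nonneg (1 / (N : ℝ)))
    linarith

lemma floorDrop_nonneg (hN : 0 < N) {c y : ℝ} (hc : 0 < c) (hy : 0 < y) :
    0 ≤ floorDrop N c y := by
  have : ⌊1 / (c * roundUp N y)⌋ ≤ ⌊1 / (c * y)⌋ := by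
    apply Int.floor_le_floor
    have := le_roundUp hN y
    gcongr
  have : ((⌊1 / (c * roundUp N y)⌋ : ℤ) : ℝ) ≤ ⌊1 / (c * y)⌋ := by exact_mod_cast this
  rw [floorDrop]; linarith

lemma antitoneOn_floor_one_div {c : ℝ} (hc : 0 < c) :
    AntitoneOn (fun y : ℝ => (⌊1 / (c * y)⌋ : ℝ)) (Set.Ioi 0) := by
  intro y hy z hz hyz
  have hy : 0 < y := hy
  have : ⌊1 / (c * z)⌋ ≤ ⌊1 / (c * y)⌋ := by
    apply Int.floor_le_floor
    gcongr
  exact Int.cast_le.2 this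

/-- With `H y = ⌊1/(cy)⌋` antitone and rounding moving `y` by at most `h = 1/N`, the integrand is at
most `H y - H (y + h)`. The integral of this telescopes to `∫ H` over `[y₀, y₀ + h]` minus a
nonnegative integral beyond 1. -/
lemma lintegral_floorDrop_le (hN : 0 < N) {c y₀ : ℝ} (hc : 0 < c) (hy₀ : 0 < y₀) (h1 : y₀ ≤ 1) :
    ∫⁻ y in Set.Ioc y₀ 1, ENNReal.ofReal (floorDrop N c y)
      ≤ ENNReal.ofReal ((1 / N) * (1 / (c * y₀))) := by
  have hN' : (0 : ℝ) < N := by exact_mod_cast hN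
  set h : ℝ := 1 / N with hh
  have hpos : 0 < h := by positivity
  set H : ℝ → ℝ := fun y => (⌊1 / (c * y)⌋ : ℝ) with hH
  have hanti := antitoneOn_floor_one_div hc
  have hint : ∀ a b : ℝ, 0 < a → 0 < b → IntervalIntegrable H volume a b := fun a b ha hb =>
    (hanti.mono fun z hz => lt_of_lt_of_le (lt_min ha hb) hz.1).intervalIntegrable
  have hshift : IntervalIntegrable (fun y => H (y + h)) volume y₀ 1 := by
    have := (hint (y₀ + h) (1 + h) (by linarith) (by linarith)).comp_add_right h
    simpa using this
  have hI : ∫ y in y₀..1, (H y - H (y + h)) ≤ h * (1 / (c * y₀)) := by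
    rw [intervalIntegral.integral_sub (hint _ _ hy₀ one_pos) hshift,
      intervalIntegral.integral_comp_add_right (fun y => H y)]
    have e1 := intervalIntegral.integral_add_adjacent_intervals
      (hint y₀ 1 hy₀ one_pos) (hint 1 (1 + h) one_pos (by linarith))
    have e2 := intervalIntegral.integral_add_adjacent_intervals
      (hint y₀ (y₀ + h) hy₀ (by linarith)) (hint (y₀ + h) (1 + h) (by linarith) (by linarith))
    have e3 : 0 ≤ ∫ y in (1 : ℝ)..(1 + h), H y := by
      apply intervalIntegral.integral_nonneg (by linarith)
      intro u hu
      have : 0 ≤ ⌊1 / (c * u)⌋ := by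
        apply Int.floor_nonneg.2
        have : 0 < u := by linarith [hu.1]
        positivity
      simp only [hH]
      exact_mod_cast this
    have e4 : ∫ y in y₀..(y₀ + h), H y ≤ ∫ y in y₀..(y₀ + h), (1 / (c * y₀)) := by
      apply intervalIntegral.integral_mono_on (by linarith) (hint _ _ hy₀ (by linarith)) (by simp)
      intro u hu
      exact (hanti hy₀ (lt_of_lt_of_le hy₀ hu.1) hu.1).trans (Int.floor_le _)
    rw [intervalIntegral.integral_const] at e4
    simp only [add_sub_cancel_left, smul_eq_mul] at e4
    linarith
  refine le_trans ?_ (ENNReal.ofReal_le_ofReal hI)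
  rw [intervalIntegral.integral_of_le h1,
    ofReal_integral_eq_lintegral_ofReal
      ((intervalIntegrable_iff_integrableOn_Ioc_of_le h1).1 ((hint _ _ hy₀ one_pos).sub hshift))]
  · apply setLIntegral_mono' measurableSet_Ioc
    intro y hy
    apply ENNReal.ofReal_le_ofReal
    have hy0 : 0 < y := hy₀.trans hy.1
    have := hanti (lt_of_lt_of_le hy0 (le_roundUp hN y))
      (show (0 : ℝ) < y + h by linarith) (roundUp_le hN y)
    simp only [floorDrop, hH] at this ⊢
    linarith
  · filter_upwards [ae_restrict_mem measurableSet_Ioc] with y hy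
    have hy0 : 0 < y := hy₀.trans hy.1
    have := hanti hy0 (show (0 : ℝ) < y + h by linarith) (by linarith)
    simp only [Pi.zero_apply, hH] at this ⊢
    linarith

lemma measurable_floorDrop : Measurable fun p : ℝ × ℝ => floorDrop N p.1 p.2 := by
  unfold floorDrop
  have h1 : Measurable fun p : ℝ × ℝ => ⌊1 / (p.1 * p.2)⌋ := by fun_prop
  have h2 : Measurable fun p : ℝ × ℝ => ⌊1 / (p.1 * roundUp N p.2)⌋ :=
    (measurable_const.div (measurable_fst.mul (measurable_roundUp.comp measurable_snd))).floor
  exact (measurable_from_top.comp h1).sub (measurable_from_top.comp h2)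

attribute [irreducible] floorDrop roundUp

end

/-! ### The double integral of the squared difference, with free parameters `η` and `δ`. -/

section

lemma lintegral_Ioc_ofReal {f : ℝ → ℝ} {a b : ℝ} (hab : a ≤ b)
    (hf : IntervalIntegrable f volume a b) (h0 : ∀ x ∈ Set.Ioc a b, 0 ≤ f x) :
    ∫⁻ x in Set.Ioc a b, ENNReal.ofReal (f x) = ENNReal.ofReal (∫ x in a..b, f x) := by
  rw [intervalIntegral.integral_of_le hab,
    ofReal_integral_eq_lintegral_ofReal ((intervalIntegrable_iff_integrableOn_Ioc_of_le hab).1 hf)]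
  filter_upwards [ae_restrict_mem measurableSet_Ioc] with x hx using h0 x hx

lemma intervalIntegrable_const_mul_zpow {a b : ℝ} (C : ℝ) (n : ℤ) (ha : 0 < a) (hb : 0 < b) :
    IntervalIntegrable (fun x : ℝ => C * x ^ n) volume a b :=
  (intervalIntegral.intervalIntegrable_zpow
    (Or.inr fun h => (lt_min ha hb).not_ge h.1)).const_mul C

lemma lintegral_const_mul_zpow {a b C : ℝ} {n : ℤ} (hC : 0 ≤ C) (ha : 0 < a) (hab : a ≤ b)
    (hn : n ≠ -1) :
    ∫⁻ x in Set.Ioc a b, ENNReal.ofReal (C * x ^ n)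
      = ENNReal.ofReal (C * ((b ^ (n + 1) - a ^ (n + 1)) / (n + 1))) := by
  rw [lintegral_Ioc_ofReal hab (intervalIntegrable_const_mul_zpow C n ha (ha.trans_le hab)),
    intervalIntegral.integral_const_mul, integral_zpow]
  · exact Or.inr ⟨hn, fun h => (lt_min ha (ha.trans_le hab)).not_ge h.1⟩
  · intro x hx
    have : 0 < x := ha.trans hx.1
    positivity

lemma lintegral_const_div {a b C : ℝ} (hC : 0 ≤ C) (ha : 0 < a) (hab : a ≤ b) :
    ∫⁻ x in Set.Ioc a b, ENNReal.ofReal (C / x) = ENNReal.ofReal (C * Real.log (b / a)) := by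
  have e : (fun x : ℝ => C / x) = fun x => C * x ^ (-1 : ℤ) := by
    ext x; rw [zpow_neg_one, div_eq_mul_inv]
  have hi := intervalIntegrable_const_mul_zpow C (-1) ha (ha.trans_le hab)
  rw [← e] at hi
  rw [lintegral_Ioc_ofReal hab hi]
  · simp_rw [div_eq_mul_inv C]
    rw [intervalIntegral.integral_const_mul, integral_inv_of_pos ha (ha.trans_le hab)]
  · intro x hx
    have : 0 < x := ha.trans hx.1
    positivity

lemma lintegral_Ioc_const {a b C : ℝ} (hC : 0 ≤ C) :
    ∫⁻ _ in Set.Ioc a b, ENNReal.ofReal C = ENNReal.ofReal (C * (b - a)) := by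
  rw [setLIntegral_const, Real.volume_Ioc, ENNReal.ofReal_mul hC]

/-- The points of the unit square that are away from the axes and from the hyperbola near them. -/
def coreRegion (η δ : ℝ) : Set (ℝ × ℝ) := {p | η < p.1 ∧ max η (δ / p.1) < p.2}

variable {N : ℕ} {η δ : ℝ}

lemma measurableSet_coreRegion : MeasurableSet (coreRegion η δ) := by
  apply MeasurableSet.inter
  · exact measurableSet_lt measurable_const measurable_fst
  · exact measurableSet_lt (measurable_const.max (measurable_const.div measurable_fst))
      measurable_snd

lemma swap_mem_coreRegion (hη : 0 < η) {x y : ℝ} :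
    (y, x) ∈ coreRegion η δ ↔ (x, y) ∈ coreRegion η δ := by
  simp only [coreRegion, Set.mem_ofPred_eq, max_lt_iff]
  constructor
  · rintro ⟨h1, h2, h3⟩
    have hx : 0 < x := hη.trans h2
    have hy : 0 < y := hη.trans h1
    refine ⟨h2, h1, ?_⟩
    rw [div_lt_iff₀ hy] at h3
    rw [div_lt_iff₀ hx]
    linarith [mul_comm x y]
  · rintro ⟨h1, h2, h3⟩
    have hx : 0 < x := hη.trans h1
    have hy : 0 < y := hη.trans h2
    refine ⟨h2, h1, ?_⟩
    rw [div_lt_iff₀ hx] at h3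
    rw [div_lt_iff₀ hy]
    linarith [mul_comm x y]

open Classical in
/-- The part of the majorant of `(K - K†)²` that is controlled by integrating over `y` first. -/
noncomputable def coreMajorant (N : ℕ) (η δ c x y : ℝ) : ENNReal :=
  if (x, y) ∈ coreRegion η δ then
    ENNReal.ofReal (floorDrop N c y + 2 * (1 / N) ^ 2 * (1 / (x ^ 4 * y ^ 2)))
  else 0

lemma measurable_coreMajorant {c : ℝ → ℝ} (hc : Measurable c) :
    Measurable (Function.uncurry fun x y : ℝ => coreMajorant N η δ (c x) x y) := by
  have h1 : Measurable fun p : ℝ × ℝ => floorDrop N (c p.1) p.2 :=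
    (measurable_floorDrop (N := N)).comp
      (f := fun p : ℝ × ℝ => (c p.1, p.2)) ((hc.comp measurable_fst).prodMk measurable_snd)
  have h2 : Measurable fun p : ℝ × ℝ => 2 * (1 / (N : ℝ)) ^ 2 * (1 / (p.1 ^ 4 * p.2 ^ 2)) := by
    fun_prop
  exact Measurable.ite measurableSet_coreRegion (h1.add h2).ennreal_ofReal measurable_const

attribute [irreducible] coreMajorant

lemma ofReal_sq_kernel_sub_le (hN : 0 < N) (hη : 0 < η) {x y : ℝ} (hx : 0 < x) (hy : 0 < y) :
    ENNReal.ofReal ((kernelK x y - stepKernel N x y) ^ 2) ≤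
      (coreRegion η δ)ᶜ.indicator 1 (x, y)
        + (coreMajorant N η δ x x y + coreMajorant N η δ (roundUp N y) y x) := by
  by_cases h : (x, y) ∈ coreRegion η δ
  · rw [Set.indicator_of_notMem (by simpa using h), zero_add, coreMajorant, coreMajorant, if_pos h,
      if_pos ((swap_mem_coreRegion hη).2 h), ← ENNReal.ofReal_add]
    · exact ENNReal.ofReal_le_ofReal (sq_kernel_sub_le hN hx hy)
    · have := floorDrop_nonneg hN hx hy
      positivity
    · have := floorDrop_nonneg hN (hy.trans_le (le_roundUp hN y)) hx
      positivity
  · rw [Set.indicator_of_mem (by simpa using h)]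
    refine le_trans ?_ le_self_add
    simpa using sq_kernel_sub_le_one hN hx hy

/-- Allowing any `c ≥ x` covers both uses, `c = x` and `c = roundUp N x`. -/
lemma lintegral_coreMajorant_inner_le (hN : 0 < N) (hη : 0 < η) (hη1 : η ≤ 1) (hδη : δ ≤ η)
    {c x : ℝ} (hx : 0 < x) (hcx : x ≤ c) :
    ∫⁻ y in Set.Ioc 0 1, coreMajorant N η δ c x y ≤
      (Set.Ioi η).indicator (fun x => ENNReal.ofReal
        (1 / N * (1 / (x * max η (δ / x))) + 2 * (1 / N) ^ 2 * (1 / (x ^ 4 * max η (δ / x))))) x := by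
  by_cases hxη : η < x
  · rw [Set.indicator_of_mem (Set.mem_Ioi.2 hxη)]
    set y₀ := max η (δ / x) with hy₀
    have hy₀0 : 0 < y₀ := lt_max_of_lt_left hη
    have hy₀1 : y₀ ≤ 1 := by
      apply max_le hη1
      rw [div_le_one hx]
      linarith
    have hc : 0 < c := hx.trans_le hcx
    calc ∫⁻ y in Set.Ioc 0 1, coreMajorant N η δ c x y
        = ∫⁻ y in Set.Ioc 0 1, (Set.Ioi y₀).indicator (fun y => ENNReal.ofReal
            (floorDrop N c y + 2 * (1 / N) ^ 2 * (1 / (x ^ 4 * y ^ 2)))) y := by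
          congr with y
          simp only [coreMajorant, coreRegion, Set.indicator, Set.mem_ofPred_eq, Set.mem_Ioi, hxη,
            true_and, hy₀]
      _ = ∫⁻ y in Set.Ioc y₀ 1, ENNReal.ofReal
            (floorDrop N c y + 2 * (1 / N) ^ 2 * (1 / (x ^ 4 * y ^ 2))) := by
          rw [setLIntegral_indicator measurableSet_Ioi]
          congr 2
          ext y
          simp only [Set.mem_inter_iff, Set.mem_Ioi, Set.mem_Ioc]
          constructor
          · rintro ⟨h1, -, h2⟩; exact ⟨h1, h2⟩
          · rintro ⟨h1, h2⟩; exact ⟨h1, hy₀0.trans h1, h2⟩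
      _ = ∫⁻ y in Set.Ioc y₀ 1, (ENNReal.ofReal (floorDrop N c y)
            + ENNReal.ofReal ((2 * (1 / N) ^ 2 * (1 / x ^ 4)) * y ^ (-2 : ℤ))) := by
          apply setLIntegral_congr_fun measurableSet_Ioc
          intro y hy
          have hy0 : 0 < y := hy₀0.trans hy.1
          beta_reduce
          rw [← ENNReal.ofReal_add (floorDrop_nonneg hN hc hy0) (by positivity)]
          congr 2
          rw [zpow_neg]
          norm_cast
          field_simp
      _ ≤ ENNReal.ofReal (1 / N * (1 / (c * y₀)))
            + ENNReal.ofReal ((2 * (1 / N) ^ 2 * (1 / x ^ 4))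
              * ((1 ^ (-2 + 1 : ℤ) - y₀ ^ (-2 + 1 : ℤ)) / ((-2 : ℤ) + 1))) := by
          have hm : Measurable fun y => ENNReal.ofReal (floorDrop N c y) :=
            (measurable_floorDrop.comp measurable_prodMk_left).ennreal_ofReal
          rw [lintegral_add_left hm,
            lintegral_const_mul_zpow (by positivity) hy₀0 hy₀1 (by norm_num)]
          gcongr
          exact lintegral_floorDrop_le hN hc hy₀0 hy₀1
      _ ≤ _ := by
          have e : ((1 ^ (-2 + 1 : ℤ) - y₀ ^ (-2 + 1 : ℤ)) / ((-2 : ℤ) + 1) : ℝ) = 1 / y₀ - 1 := by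
            norm_num
            ring
          have h1 : 0 ≤ 1 / y₀ - 1 := by
            rw [sub_nonneg, le_div_iff₀ hy₀0]; linarith
          rw [e, ← ENNReal.ofReal_add (by positivity) (by positivity)]
          apply ENNReal.ofReal_le_ofReal
          apply add_le_add
          · gcongr
          · rw [mul_assoc]
            gcongr
            rw [one_div_mul_eq_div, div_le_div_iff₀ (by positivity) (by positivity)]
            have : (1 / y₀ - 1) * (x ^ 4 * y₀) = x ^ 4 * (1 - y₀) := by field_simp
            rw [this]
            nlinarith [pow_pos hx 4]
  · rw [Set.indicator_of_notMem (by simpa using hxη)]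
    simp [coreMajorant, coreRegion, hxη]

/-- The maximum changes branch at `x = δ/η`: below it the first term is at most the constant
`1/(Nδ)`, above it `1/(Nηx)`, which produces the logarithm. In the second term the branch `δ/x` is
used throughout. -/
lemma lintegral_coreMajorant_outer_le (hN : 0 < N) (hη : 0 < η) (hδη : δ ≤ η)
    (hηδ : η ^ 2 ≤ δ) :
    ∫⁻ x in Set.Ioc 0 1, (Set.Ioi η).indicator (fun x => ENNReal.ofReal
        (1 / N * (1 / (x * max η (δ / x))) + 2 * (1 / N) ^ 2 * (1 / (x ^ 4 * max η (δ / x))))) x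
      ≤ ENNReal.ofReal (1 / N * (1 / η) * (1 + Real.log (η / δ)) + (1 / N) ^ 2 * (1 / (η ^ 2 * δ))) := by
  have hδ : 0 < δ := lt_of_lt_of_le (by positivity) hηδ
  have h1 : η ≤ δ / η := by rw [le_div_iff₀ hη]; linarith [sq η]
  have h2 : δ / η ≤ 1 := by rw [div_le_one hη]; exact hδη
  have hη1 : η ≤ 1 := h1.trans h2
  have hmeas : ∀ C : ℝ, ∀ n : ℤ, Measurable fun x : ℝ => ENNReal.ofReal (C * x ^ n) :=
    fun C n => by fun_prop
  calc _ ≤ ∫⁻ x in Set.Ioc 0 1, ((Set.Ioc η (δ / η)).indicator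
            (fun _ => ENNReal.ofReal (1 / N * (1 / δ))) x
          + (Set.Ioc (δ / η) 1).indicator (fun x => ENNReal.ofReal (1 / N * (1 / η) / x)) x
          + (Set.Ioc η 1).indicator
            (fun x => ENNReal.ofReal (2 * (1 / N) ^ 2 * (1 / δ) * x ^ (-3 : ℤ))) x) := by
        apply setLIntegral_mono' measurableSet_Ioc
        intro x hx
        by_cases hxη : η < x
        · have hm0 : 0 < max η (δ / x) := lt_max_of_lt_left hη
          rw [Set.indicator_of_mem (Set.mem_Ioi.2 hxη),
            Set.indicator_of_mem (show x ∈ Set.Ioc η 1 from ⟨hxη, hx.2⟩),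
            ENNReal.ofReal_add (by have := hx.1; positivity) (by have := hx.1; positivity)]
          apply add_le_add
          · by_cases hxδ : x ≤ δ / η
            · rw [Set.indicator_of_mem (show x ∈ Set.Ioc η (δ / η) from ⟨hxη, hxδ⟩)]
              refine le_trans ?_ le_self_add
              apply ENNReal.ofReal_le_ofReal
              gcongr
              calc δ = x * (δ / x) := by have := hx.1; field_simp
                _ ≤ _ := mul_le_mul_of_nonneg_left (le_max_right _ _) hx.1.le
            · rw [Set.indicator_of_mem (show x ∈ Set.Ioc (δ / η) 1 from ⟨not_le.1 hxδ, hx.2⟩)]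
              refine le_trans ?_ le_add_self
              apply ENNReal.ofReal_le_ofReal
              rw [mul_div_assoc, div_div, mul_comm η x]
              have := hx.1
              gcongr
              exact le_max_left _ _
          · apply ENNReal.ofReal_le_ofReal
            have hx0 := hx.1
            rw [mul_assoc (2 * (1 / (N : ℝ)) ^ 2)]
            gcongr
            rw [zpow_neg]
            norm_cast
            rw [one_div, one_div, ← mul_inv]
            apply inv_anti₀ (by positivity)
            calc δ * x ^ 3 = x ^ 4 * (δ / x) := by field_simp
              _ ≤ _ := mul_le_mul_of_nonneg_left (le_max_right _ _) (by positivity)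
        · rw [Set.indicator_of_notMem (by simpa using hxη)]
          exact zero_le
    _ = (∫⁻ x in Set.Ioc η (δ / η), ENNReal.ofReal (1 / N * (1 / δ)))
          + (∫⁻ x in Set.Ioc (δ / η) 1, ENNReal.ofReal (1 / N * (1 / η) / x))
          + ∫⁻ x in Set.Ioc η 1, ENNReal.ofReal (2 * (1 / N) ^ 2 * (1 / δ) * x ^ (-3 : ℤ)) := by
        have hI : ∀ a b : ℝ, 0 < a → b ≤ 1 → Set.Ioc a b ∩ Set.Ioc 0 1 = Set.Ioc a b := by
          intro a b ha hb
          apply Set.inter_eq_left.2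
          exact Set.Ioc_subset_Ioc ha.le hb
        rw [lintegral_add_right _ ((hmeas _ _).indicator measurableSet_Ioc),
          lintegral_add_left (measurable_const.indicator measurableSet_Ioc),
          setLIntegral_indicator measurableSet_Ioc, setLIntegral_indicator measurableSet_Ioc,
          setLIntegral_indicator measurableSet_Ioc, hI _ _ hη h2, hI _ _ (by positivity) le_rfl,
          hI _ _ hη le_rfl]
    _ ≤ _ := by
        have e1 : (1 : ℝ) / (δ / η) = η / δ := by field_simp
        have e2 : ((1 : ℝ) ^ (-3 + 1 : ℤ) - η ^ (-3 + 1 : ℤ)) / ((-3 : ℤ) + 1)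
            = (1 / η ^ 2 - 1) / 2 := by
          have : ((-3 : ℤ) + 1) = -2 := by norm_num
          rw [this, one_zpow, zpow_neg]
          norm_cast
          push_cast
          ring
        have e3 : 1 / (N : ℝ) * (1 / δ) * (δ / η - η) = 1 / N * (1 / η) - 1 / N * (η / δ) := by
          field_simp
        have e4 : 2 * (1 / (N : ℝ)) ^ 2 * (1 / δ) * ((1 / η ^ 2 - 1) / 2)
            = (1 / N) ^ 2 * (1 / (η ^ 2 * δ)) - (1 / N) ^ 2 * (1 / δ) := by
          field_simp
        have p1 : 0 ≤ 1 / (N : ℝ) * (η / δ) := by positivity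
        have p2 : 0 ≤ (1 / (N : ℝ)) ^ 2 * (1 / δ) := by positivity
        have p3 : 0 ≤ 1 / (N : ℝ) * (1 / δ) * (δ / η - η) :=
          mul_nonneg (by positivity) (by linarith)
        have p4 : 0 ≤ 1 / (N : ℝ) * (1 / η) * Real.log (η / δ) :=
          mul_nonneg (by positivity) (Real.log_nonneg (by rw [one_le_div (by positivity)]; exact hδη))
        have p5 : 0 ≤ 2 * (1 / (N : ℝ)) ^ 2 * (1 / δ) * ((1 / η ^ 2 - 1) / 2) := by
          apply mul_nonneg (by positivity)
          have : 1 ≤ 1 / η ^ 2 := by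
            rw [one_le_div (by positivity)]
            exact pow_le_one₀ hη.le hη1
          linarith
        rw [lintegral_Ioc_const (by positivity), lintegral_const_div (by positivity) (by positivity) h2,
          lintegral_const_mul_zpow (by positivity) hη hη1 (by norm_num), e1, e2,
          ← ENNReal.ofReal_add p3 p4, ← ENNReal.ofReal_add (add_nonneg p3 p4) p5]
        apply ENNReal.ofReal_le_ofReal
        rw [e3, e4]
        linarith

/-- The right side is the area outside the region: the strip `x ≤ η` gives `η`, the part under the
hyperbola `y = δ/x` gives the logarithm, and the strip `y ≤ η` over `x > δ/η` gives `η - δ`. -/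
lemma lintegral_compl_coreRegion_le (hη : 0 < η) (hδη : δ ≤ η) (hηδ : η ^ 2 ≤ δ) :
    ∫⁻ x in Set.Ioc 0 1, ∫⁻ y in Set.Ioc 0 1, (coreRegion η δ)ᶜ.indicator (1 : ℝ × ℝ → ENNReal) (x, y)
      ≤ ENNReal.ofReal (2 * η + δ * Real.log (δ / η ^ 2) - δ) := by
  have hδ : 0 < δ := lt_of_lt_of_le (by positivity) hηδ
  have h1 : η ≤ δ / η := by rw [le_div_iff₀ hη]; linarith [sq η]
  have h2 : δ / η ≤ 1 := by rw [div_le_one hη]; exact hδη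
  have hη1 : η ≤ 1 := h1.trans h2
  calc _ ≤ ∫⁻ x in Set.Ioc 0 1, ((Set.Ioc 0 η).indicator (fun _ => ENNReal.ofReal 1) x
          + (Set.Ioc η (δ / η)).indicator (fun x => ENNReal.ofReal (δ / x)) x
          + (Set.Ioc (δ / η) 1).indicator (fun _ => ENNReal.ofReal η) x) := by
        apply setLIntegral_mono' measurableSet_Ioc
        intro x hx
        by_cases hxη : η < x
        · have hle : ∫⁻ y in Set.Ioc 0 1, (coreRegion η δ)ᶜ.indicator (1 : ℝ × ℝ → ENNReal) (x, y)
              ≤ ENNReal.ofReal (max η (δ / x)) := by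
            calc _ ≤ ∫⁻ y in Set.Ioc 0 1, (Set.Iic (max η (δ / x))).indicator (1 : ℝ → ENNReal) y := by
                  apply lintegral_mono
                  intro y
                  by_cases hy : y ≤ max η (δ / x)
                  · rw [Set.indicator_of_mem (Set.mem_Iic.2 hy)]
                    exact Set.indicator_le_self _ (1 : ℝ × ℝ → ENNReal) _
                  · beta_reduce
                    have hmem : (x, y) ∈ coreRegion η δ := ⟨hxη, not_le.1 hy⟩
                    rw [Set.indicator_of_notMem (show (x, y) ∉ (coreRegion η δ)ᶜ from
                      fun h => h hmem)]
                    exact zero_le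
              _ = volume (Set.Iic (max η (δ / x)) ∩ Set.Ioc 0 1) := by
                  rw [setLIntegral_indicator measurableSet_Iic]; simp
              _ ≤ volume (Set.Ioc 0 (max η (δ / x))) :=
                  measure_mono fun y hy => ⟨hy.2.1, hy.1⟩
              _ = _ := by rw [Real.volume_Ioc, sub_zero]
          refine hle.trans ?_
          by_cases hxδ : x ≤ δ / η
          · rw [Set.indicator_of_mem (show x ∈ Set.Ioc η (δ / η) from ⟨hxη, hxδ⟩), max_eq_right]
            · exact le_trans le_add_self le_self_add
            · rw [le_div_iff₀ hx.1]; rw [le_div_iff₀ hη] at hxδ; linarith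
          · rw [Set.indicator_of_mem (show x ∈ Set.Ioc (δ / η) 1 from ⟨not_le.1 hxδ, hx.2⟩),
              max_eq_left]
            · exact le_add_self
            · rw [not_le, div_lt_iff₀ hη] at hxδ; rw [div_le_iff₀ hx.1]; linarith
        · rw [Set.indicator_of_mem (show x ∈ Set.Ioc 0 η from ⟨hx.1, not_lt.1 hxη⟩)]
          refine le_trans ?_ (le_trans le_self_add le_self_add)
          calc _ ≤ ∫⁻ _ in Set.Ioc (0 : ℝ) 1, (1 : ENNReal) :=
                lintegral_mono fun y => Set.indicator_le_self _ (1 : ℝ × ℝ → ENNReal) (x, y)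
            _ = _ := by simp
    _ = (∫⁻ x in Set.Ioc 0 η, ENNReal.ofReal 1)
          + (∫⁻ x in Set.Ioc η (δ / η), ENNReal.ofReal (δ / x))
          + ∫⁻ x in Set.Ioc (δ / η) 1, ENNReal.ofReal η := by
        have hI : ∀ a b : ℝ, 0 ≤ a → b ≤ 1 → Set.Ioc a b ∩ Set.Ioc 0 1 = Set.Ioc a b := by
          intro a b ha hb
          apply Set.inter_eq_left.2
          exact Set.Ioc_subset_Ioc ha hb
        rw [lintegral_add_right _ (measurable_const.indicator measurableSet_Ioc),
          lintegral_add_left (measurable_const.indicator measurableSet_Ioc),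
          setLIntegral_indicator measurableSet_Ioc, setLIntegral_indicator measurableSet_Ioc,
          setLIntegral_indicator measurableSet_Ioc, hI _ _ le_rfl hη1, hI _ _ (by positivity) h2,
          hI _ _ (by positivity) le_rfl]
    _ = _ := by
        have hl : 0 ≤ Real.log (δ / η / η) :=
          Real.log_nonneg (by rw [one_le_div hη]; exact h1)
        rw [lintegral_Ioc_const (by positivity), lintegral_Ioc_const (by positivity),
          lintegral_const_div (by positivity) hη h1,
          ← ENNReal.ofReal_add (by linarith) (by positivity),
          ← ENNReal.ofReal_add (add_nonneg (by linarith) (by positivity))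
            (mul_nonneg hη.le (by linarith))]
        congr 1
        rw [div_div, ← sq]
        field_simp
        ring

lemma lintegral_lintegral_add_add {μ : Measure ℝ} [SFinite μ] {f g k : ℝ → ℝ → ENNReal}
    (hf : Measurable (Function.uncurry f)) (hg : Measurable (Function.uncurry g)) :
    ∫⁻ x, ∫⁻ y, (f x y + (g x y + k x y)) ∂μ ∂μ
      = (∫⁻ x, ∫⁻ y, f x y ∂μ ∂μ) + ((∫⁻ x, ∫⁻ y, g x y ∂μ ∂μ) + ∫⁻ x, ∫⁻ y, k x y ∂μ ∂μ) := by
  have hf1 : Measurable fun x => ∫⁻ y, f x y ∂μ := hf.lintegral_prod_right'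
  have hg1 : Measurable fun x => ∫⁻ y, g x y ∂μ := hg.lintegral_prod_right'
  rw [← lintegral_add_left hg1, ← lintegral_add_left hf1]
  refine lintegral_congr fun x => ?_
  have hf2 : Measurable (f x) := hf.comp measurable_prodMk_left
  have hg2 : Measurable (g x) := hg.comp measurable_prodMk_left
  rw [← lintegral_add_left hg2, ← lintegral_add_left hf2]

lemma lintegral_sq_kernel_sub_le (hN : 0 < N) (hη : 0 < η) (hδη : δ ≤ η) (hηδ : η ^ 2 ≤ δ) :
    ∫⁻ x in Set.Ioc 0 1, ∫⁻ y in Set.Ioc 0 1,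
        ENNReal.ofReal ((kernelK x y - stepKernel N x y) ^ 2)
      ≤ ENNReal.ofReal ((2 * η + δ * Real.log (δ / η ^ 2) - δ)
        + 2 * (1 / N * (1 / η) * (1 + Real.log (η / δ)) + (1 / N) ^ 2 * (1 / (η ^ 2 * δ)))) := by
  have hδ : 0 < δ := lt_of_lt_of_le (by positivity) hηδ
  have h1 : η ≤ δ / η := by rw [le_div_iff₀ hη]; linarith [sq η]
  have h2 : δ / η ≤ 1 := by rw [div_le_one hη]; exact hδη
  have hη1 : η ≤ 1 := h1.trans h2
  set M₁ := 2 * η + δ * Real.log (δ / η ^ 2) - δ with hM₁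
  set M₂ := 1 / N * (1 / η) * (1 + Real.log (η / δ)) + (1 / N) ^ 2 * (1 / (η ^ 2 * δ)) with hM₂
  have hM₁0 : 0 ≤ M₁ := by
    have : 0 ≤ δ * Real.log (δ / η ^ 2) :=
      mul_nonneg hδ.le (Real.log_nonneg (by rw [one_le_div (by positivity)]; exact hηδ))
    linarith
  have hM₂0 : 0 ≤ M₂ := by
    have : 0 ≤ Real.log (η / δ) :=
      Real.log_nonneg (by rw [one_le_div (by positivity)]; exact hδη)
    positivity
  have m0 : Measurable (Function.uncurry fun x y : ℝ =>
      (coreRegion η δ)ᶜ.indicator (1 : ℝ × ℝ → ENNReal) (x, y)) :=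
    measurable_one.indicator measurableSet_coreRegion.compl
  have mB : ∀ c : ℝ → ℝ, Measurable c → Measurable (Function.uncurry fun x y : ℝ =>
      coreMajorant N η δ (c x) x y) := fun c hc => measurable_coreMajorant hc
  have m1 := mB id measurable_id
  have m2 := mB (roundUp N) measurable_roundUp
  have m2' : Measurable (Function.uncurry fun x y : ℝ =>
      coreMajorant N η δ (roundUp N y) y x) := m2.comp measurable_swap
  have hb : ∀ c : ℝ → ℝ, (∀ x, x ≤ c x) →
      ∫⁻ x in Set.Ioc 0 1, ∫⁻ y in Set.Ioc 0 1, coreMajorant N η δ (c x) x y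
        ≤ ENNReal.ofReal M₂ := by
    intro c hc
    refine le_trans ?_ (lintegral_coreMajorant_outer_le hN hη hδη hηδ)
    apply setLIntegral_mono' measurableSet_Ioc
    intro x hx
    exact lintegral_coreMajorant_inner_le hN hη hη1 hδη hx.1 (hc x)
  have hmaj : ∫⁻ x in Set.Ioc 0 1, ∫⁻ y in Set.Ioc 0 1,
        ENNReal.ofReal ((kernelK x y - stepKernel N x y) ^ 2)
      ≤ ∫⁻ x in Set.Ioc 0 1, ∫⁻ y in Set.Ioc 0 1,
        ((coreRegion η δ)ᶜ.indicator (1 : ℝ × ℝ → ENNReal) (x, y)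
        + (coreMajorant N η δ x x y + coreMajorant N η δ (roundUp N y) y x)) := by
    apply setLIntegral_mono' measurableSet_Ioc
    intro x hx
    apply setLIntegral_mono' measurableSet_Ioc
    intro y hy
    exact ofReal_sq_kernel_sub_le hN hη hx.1 hy.1
  have hsum := lintegral_lintegral_add_add (μ := volume.restrict (Set.Ioc (0 : ℝ) 1)) m0 m1
    (k := fun x y => coreMajorant N η δ (roundUp N y) y x)
  refine (hmaj.trans hsum.le).trans ?_
  -- Tonelli: in the second majorant `x` is the rounded variable, so it must be integrated first;
  -- after the swap it has the form of `hb` with `c = roundUp N`.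
  have hswap := lintegral_lintegral_swap (μ := volume.restrict (Set.Ioc (0 : ℝ) 1))
    (ν := volume.restrict (Set.Ioc (0 : ℝ) 1)) m2'.aemeasurable
  rw [ENNReal.ofReal_add hM₁0 (by positivity), two_mul, ENNReal.ofReal_add hM₂0 hM₂0]
  refine add_le_add (lintegral_compl_coreRegion_le hη hδη hηδ)
    (add_le_add (hb id fun _ => le_rfl) ?_)
  exact hswap.le.trans (hb (roundUp N) (le_roundUp hN))

end

/-! ### Choice of parameters and comparison of constants. -/

section

/-- An explicit bound for the squared Hilbert–Schmidt distance of `kernelK` and `stepKernel N`. -/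
noncomputable def hsBound (N : ℕ) : ℝ :=
  (4 + √(Real.log N) - 2 / √(Real.log N) * Real.log (2 * √(Real.log N)) - 2 / √(Real.log N)
    + (1 + Real.log √(Real.log N)) + √(Real.log N) / 4) / √N

variable {N : ℕ}

lemma three_lt_log (hN : 25 ≤ N) : 3 < Real.log N := by
  have h : (25 : ℝ) ≤ N := by exact_mod_cast hN
  rw [Real.lt_log_iff_exp_lt (by linarith)]
  have h1 := Real.exp_one_lt_d9
  have h2 : Real.exp 3 = Real.exp 1 ^ 3 := by rw [← Real.exp_nat_mul]; norm_num
  have h3 : Real.exp 1 ^ 3 ≤ 2.72 ^ 3 := by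
    apply pow_le_pow_left₀ (Real.exp_pos 1).le
    linarith
  rw [h2]
  norm_num at h3 ⊢
  linarith

lemma one_lt_sqrt_log (hN : 25 ≤ N) : 1 < √(Real.log N) := by
  rw [Real.lt_sqrt (by norm_num)]
  linarith [three_lt_log hN]

lemma log_le_div_add_log_sub_one {x a : ℝ} (hx : 0 < x) (ha : 0 < a) :
    Real.log x ≤ x / a + Real.log a - 1 := by
  have := Real.log_le_sub_one_of_pos (div_pos hx ha)
  rw [Real.log_div hx.ne' ha.ne'] at this
  linarith

/-- This is the condition `η² ≤ δ` for the parameters `η = 2/√N`, `δ = 2/√(N log N)`. -/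
lemma two_mul_sqrt_log_le (hN : 25 ≤ N) : 2 * √(Real.log N) ≤ √N := by
  have h : (25 : ℝ) ≤ N := by exact_mod_cast hN
  have hr : 5 ≤ √(N : ℝ) := Real.le_sqrt_of_sq_le (by norm_num1; exact h)
  have hsq : √(N : ℝ) ^ 2 = N := Real.sq_sqrt (by linarith)
  have hlog : Real.log N = 2 * Real.log √(N : ℝ) := by
    rw [← hsq, Real.log_pow]; push_cast; rw [hsq]
  have h1 := log_le_div_add_log_sub_one (x := √(N : ℝ)) (a := 2) (by linarith) two_pos
  have h2 := Real.log_two_lt_d9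
  rw [← le_div_iff₀' two_pos]
  apply Real.sqrt_le_iff.2 ⟨by positivity, ?_⟩
  rw [hlog]
  nlinarith

lemma lintegral_sq_kernel_sub_le_hsBound (hN : 25 ≤ N) :
    ∫⁻ x in Set.Ioc 0 1, ∫⁻ y in Set.Ioc 0 1,
        ENNReal.ofReal ((kernelK x y - stepKernel N x y) ^ 2) ≤ ENNReal.ofReal (hsBound N) := by
  have h : (25 : ℝ) ≤ N := by exact_mod_cast hN
  set r := √(N : ℝ) with hr
  set s := √(Real.log N) with hs
  have hr0 : 0 < r := Real.sqrt_pos.2 (by linarith)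
  have hs1 : 1 < s := one_lt_sqrt_log hN
  have hs0 : 0 < s := by linarith
  have hr2 : r ^ 2 = N := Real.sq_sqrt (by linarith)
  have hs2 : s ^ 2 = Real.log N := Real.sq_sqrt (by linarith [three_lt_log hN])
  have hrs : 2 * s ≤ r := two_mul_sqrt_log_le hN
  have hlog : Real.log r = s ^ 2 / 2 := by
    rw [hs2, ← hr2, Real.log_pow]; push_cast; ring
  -- Up to constants, this `η` balances `2η` against `1/(Nη)`, and this `δ` balances `δ log N`
  -- against `1/(N²η²δ)`.
  refine (lintegral_sq_kernel_sub_le (η := 2 / r) (δ := 2 / (r * s)) (by omega) (by positivity)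
    ?_ ?_).trans (le_of_eq ?_)
  · gcongr
    nlinarith
  · rw [div_pow, div_le_div_iff₀ (by positivity) (by positivity)]
    nlinarith [mul_le_mul_of_nonneg_left hrs hr0.le]
  · congr 1
    have e1 : 2 / (r * s) / (2 / r) ^ 2 = r / (2 * s) := by field_simp
    have e2 : 2 / r / (2 / (r * s)) = s := by field_simp
    rw [e1, e2, Real.log_div hr0.ne' (by positivity), hlog, hsBound, ← hs, ← hr, ← hr2]
    field_simp
    ring

lemma hsBound_lt (hN : 25 ≤ N) : hsBound N < bracket N / √N := by
  have h : (25 : ℝ) ≤ N := by exact_mod_cast hN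
  have hr0 : 0 < √(N : ℝ) := Real.sqrt_pos.2 (by linarith)
  have hs1 : 1 < √(Real.log N) := one_lt_sqrt_log hN
  have h3 := three_lt_log hN
  have hlog : Real.log (Real.log N) = 2 * Real.log √(Real.log N) := by
    rw [Real.log_sqrt (by linarith)]; ring
  have hmid : 4 / 9 ≤ (1 + 1 / √(N : ℝ)) ^ 8 * (4 / 9 + 23 / 30 * (N : ℝ) ^ (-(1 / 6) : ℝ)) := by
    have h1 : 1 ≤ (1 + 1 / √(N : ℝ)) ^ 8 := by
      apply one_le_pow₀
      have : 0 ≤ 1 / √(N : ℝ) := by positivity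
      linarith
    have h2 : 0 ≤ (N : ℝ) ^ (-(1 / 6) : ℝ) := by positivity
    nlinarith
  rw [hsBound, bracket, hlog]
  apply div_lt_div_of_pos_right _ hr0
  -- Only `4/9` of the middle term of `bracket` is needed.
  refine lt_of_lt_of_le ?_ (add_le_add_left (add_le_add_right hmid _) _)
  set s := √(Real.log N) with hs
  have hs0 : 0 < s := by linarith
  rw [Real.log_mul two_ne_zero hs0.ne']
  have hl2 := Real.log_two_gt_d9
  have hl2' := Real.log_two_lt_d9
  have hl0 : 0 ≤ Real.log s := Real.log_nonneg hs1.le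
  have key : (s - 4) * Real.log s + 41 / 9 * s < 3 / 4 * s ^ 2 + 11 + 2 * Real.log 2 := by
    -- The product `(s - 4) log s` changes sign at `s = 4`. Beyond it `log s` is replaced by its
    -- tangent line there; `0.387` exceeds `2 log 2 - 1`.
    rcases le_or_gt s 4 with h4 | h4
    · have : (s - 4) * Real.log s ≤ 0 := mul_nonpos_of_nonpos_of_nonneg (by linarith) hl0
      nlinarith [sq_nonneg (s - 3)]
    · have h5 := log_le_div_add_log_sub_one (x := s) (a := 4) hs0 (by norm_num)
      have h6 : Real.log 4 = 2 * Real.log 2 := by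
        rw [show (4 : ℝ) = 2 ^ 2 by norm_num, Real.log_pow]; norm_num
      have h7 : (s - 4) * Real.log s ≤ (s - 4) * (s / 4 + 0.387) := by
        apply mul_le_mul_of_nonneg_left _ (by linarith)
        rw [h6] at h5
        linarith
      nlinarith [sq_nonneg (s - 4)]
  have e : 2 * s + 4 / 9 + (2 * Real.log s + 9) / s
      - (4 + s - 2 / s * (Real.log 2 + Real.log s) - 2 / s + (1 + Real.log s) + s / 4)
      = (3 / 4 * s ^ 2 + 11 + 2 * Real.log 2 - ((s - 4) * Real.log s + 41 / 9 * s)) / s := by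
    field_simp
    ring
  have : 0 < (3 / 4 * s ^ 2 + 11 + 2 * Real.log 2 - ((s - 4) * Real.log s + 41 / 9 * s)) / s :=
    div_pos (by linarith) hs0
  linarith

/-- A cruder form whose limit is evidently 0; it serves the compactness of the operator of `K`. -/
lemma hsBound_le (hN : 25 ≤ N) : hsBound N ≤ 8 * √(Real.log N / N) := by
  have h : (25 : ℝ) ≤ N := by exact_mod_cast hN
  have hr0 : 0 < √(N : ℝ) := Real.sqrt_pos.2 (by linarith)
  have hs1 : 1 < √(Real.log N) := one_lt_sqrt_log hN
  rw [Real.sqrt_div (by linarith [three_lt_log hN]), ← mul_div_assoc, hsBound]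
  apply div_le_div_of_nonneg_right _ hr0.le
  set s := √(Real.log N) with hs
  have hs0 : 0 < s := by linarith
  have h1 : 0 ≤ 2 / s * Real.log (2 * s) :=
    mul_nonneg (by positivity) (Real.log_nonneg (by linarith))
  have h2 : 0 ≤ 2 / s := by positivity
  have h3 := Real.log_le_sub_one_of_pos hs0
  linarith

lemma tendsto_hsBound :
    Filter.Tendsto (fun N : ℕ => 8 * √(Real.log N / N)) Filter.atTop (nhds 0) := by
  have h1 : Filter.Tendsto (fun x : ℝ => Real.log x / x) Filter.atTop (nhds 0) :=
    Real.isLittleO_log_id_atTop.tendsto_div_nhds_zero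
  have h2 := (h1.comp tendsto_natCast_atTop_atTop).sqrt.const_mul 8
  simpa using h2

lemma lintegral_unitInterval_eq (F : ℝ → ENNReal) :
    ∫⁻ x : unitInterval, F x = ∫⁻ x in Set.Ioc 0 1, F x := by
  rw [Measure.restrict_congr_set Ioc_ae_eq_Icc]
  exact lintegral_subtype_comap measurableSet_Icc F

lemma lintegral_unitInterval_sq_kernel_sub_le (hN : 25 ≤ N) :
    ∫⁻ x : unitInterval, ∫⁻ y : unitInterval,
        ENNReal.ofReal ((kernelK x y - stepKernel N x y) ^ 2) ≤ ENNReal.ofReal (hsBound N) := by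
  refine le_trans (le_of_eq ?_) (lintegral_sq_kernel_sub_le_hsBound hN)
  rw [← lintegral_unitInterval_eq (fun x => ∫⁻ y in Set.Ioc 0 1,
        ENNReal.ofReal ((kernelK x y - stepKernel N x y) ^ 2))]
  refine lintegral_congr fun x => ?_
  exact lintegral_unitInterval_eq fun y => ENNReal.ofReal ((kernelK x y - stepKernel N x y) ^ 2)

end

/-! ### Courant–Fischer and Weyl's inequality for compact symmetric operators. -/

section

section Spectral

variable {H : Type*} [NormedAddCommGroup H] [InnerProductSpace ℂ H]
  {T : H →L[ℂ] H}

lemma re_inner_le_of_spectrum_le [CompleteSpace H] (hT : IsSelfAdjoint T) {r : ℝ}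
    (h : ∀ x ∈ spectrum ℝ T, x ≤ r) (v : H) : (inner ℂ (T v) v).re ≤ r * ‖v‖ ^ 2 := by
  have hle := le_algebraMap_of_spectrum_le h hT
  rw [ContinuousLinearMap.le_def] at hle
  have h := hle.re_inner_nonneg_left v
  have e : (algebraMap ℝ (H →L[ℂ] H) r - T) v = (r : ℂ) • v - T v := rfl
  rw [e, inner_sub_left, map_sub, inner_smul_left, inner_self_eq_norm_sq_to_K] at h
  simp only [Complex.conj_ofReal, RCLike.re_to_complex, Complex.coe_algebraMap] at h
  norm_cast at h
  linarith

/-- The common orthogonal complement `W` of the eigenspaces above `r` is closed and invariant. A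
spectral value above `r` of the compact restriction to `W` would be an eigenvalue, with an
eigenvector orthogonal to its own eigenspace. So that spectrum is at most `r`. -/
lemma re_inner_le_of_mem_orthogonal_eigenspace [CompleteSpace H] (hT : IsCompactOperator T) (hS : T.IsSymmetric)
    {r : ℝ} (hr : 0 < r) {v : H}
    (hv : ∀ μ : ℝ, r < μ → v ∈ (eigenspace (T : Module.End ℂ H) (μ : ℂ))ᗮ) :
    (inner ℂ (T v) v).re ≤ r * ‖v‖ ^ 2 := by
  set W : Submodule ℂ H := ⨅ μ : Set.Ioi r, (eigenspace (T : Module.End ℂ H) ((μ : ℝ) : ℂ))ᗮ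
    with hW
  have hvW : v ∈ W := by
    rw [hW, Submodule.mem_iInf]
    exact fun μ => hv μ μ.2
  have hinv : ∀ w ∈ W, T w ∈ W := by
    intro w hw
    rw [hW, Submodule.mem_iInf] at hw ⊢
    exact fun μ => hS.invariant_orthogonalComplement_eigenspace _ w (hw μ)
  have hclosed : IsClosed (W : Set H) := by
    rw [hW, Submodule.coe_iInf]
    exact isClosed_iInter fun μ => Submodule.isClosed_orthogonal _
  have : CompleteSpace W := hclosed.completeSpace_coe
  let S : W →L[ℂ] W := T.restrict hinv
  have hSc : IsCompactOperator S := hT.restrict' hinv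
  have hSs : S.IsSymmetric := hS.restrict_invariant hinv
  have hsa : IsSelfAdjoint S := hSs.isSelfAdjoint
  have hspec : ∀ x ∈ spectrum ℝ S, x ≤ r := by
    intro x hx
    by_contra! hrx
    have hx' : (x : ℂ) ∈ spectrum ℂ S := by
      simpa using spectrum.algebraMap_mem ℂ hx
    have hx0 : (x : ℂ) ≠ 0 := by
      exact_mod_cast (hr.trans hrx).ne'
    obtain ⟨w, hw, hw0⟩ := ((hSc.hasEigenvalue_iff_mem_spectrum hx0).2 hx').exists_hasEigenvector
    rw [mem_eigenspace_iff] at hw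
    have hTw : T w = (x : ℂ) • (w : H) := congrArg Subtype.val hw
    have h1 : (w : H) ∈ eigenspace (T : Module.End ℂ H) (x : ℂ) := by
      rw [mem_eigenspace_iff]; exact hTw
    have h2 : (w : H) ∈ (eigenspace (T : Module.End ℂ H) (x : ℂ))ᗮ := by
      exact (Submodule.mem_iInf _).1 w.2 (⟨x, hrx⟩ : Set.Ioi r)
    exact hw0 (Subtype.ext (inner_self_eq_zero.1 (h2 _ h1)))
  exact re_inner_le_of_spectrum_le hsa hspec ⟨v, hvW⟩

/-- There is a `j`-dimensional subspace on which the quadratic form of `T` is at least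
`t ‖v‖²`. -/
def HasFormSubspace (T : H →L[ℂ] H) (j : ℕ) (t : ℝ) : Prop :=
  ∃ V : Submodule ℂ H, FiniteDimensional ℂ V ∧ Module.finrank ℂ V = j ∧
    ∀ v ∈ V, t * ‖v‖ ^ 2 ≤ (inner ℂ (T v) v).re

lemma re_inner_le_norm_mul_sq (T : H →L[ℂ] H) (v : H) :
    (inner ℂ (T v) v).re ≤ ‖T‖ * ‖v‖ ^ 2 := by
  calc (inner ℂ (T v) v).re ≤ ‖inner ℂ (T v) v‖ := Complex.re_le_norm _
    _ ≤ ‖T v‖ * ‖v‖ := norm_inner_le_norm _ _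
    _ ≤ (‖T‖ * ‖v‖) * ‖v‖ := by gcongr; exact T.le_opNorm v
    _ = _ := by ring

lemma HasFormSubspace.le_norm {j : ℕ} {t : ℝ} (hj : 1 ≤ j) (h : HasFormSubspace T j t) :
    t ≤ ‖T‖ := by
  obtain ⟨V, hV, hVj, hVt⟩ := h
  have : Nontrivial V := Module.nontrivial_of_finrank_pos (R := ℂ) (by omega)
  obtain ⟨v, hv⟩ := exists_ne (0 : V)
  have hv0 : 0 < ‖(v : H)‖ ^ 2 := by
    have : (v : H) ≠ 0 := by simpa using hv
    positivity
  have := (hVt v v.2).trans (re_inner_le_norm_mul_sq T v)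
  exact le_of_mul_le_mul_right this hv0

lemma HasFormSubspace.mono {j : ℕ} {t t' : ℝ} (h : HasFormSubspace T j t) (ht : t' ≤ t) :
    HasFormSubspace T j t' := by
  obtain ⟨V, hV, hVj, hVt⟩ := h
  exact ⟨V, hV, hVj, fun v hv =>
    (mul_le_mul_of_nonneg_right ht (sq_nonneg _)).trans (hVt v hv)⟩

lemma HasFormSubspace.sub {T' : H →L[ℂ] H} {j : ℕ} {t ε : ℝ} (h : HasFormSubspace T j t)
    (hε : ‖T - T'‖ ≤ ε) : HasFormSubspace T' j (t - ε) := by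
  obtain ⟨V, hV, hVj, hVt⟩ := h
  refine ⟨V, hV, hVj, fun v hv => ?_⟩
  have h1 := re_inner_le_norm_mul_sq (T - T') v
  rw [_root_.sub_apply, inner_sub_left, Complex.sub_re] at h1
  have h2 := hVt v hv
  have h3 : ‖T - T'‖ * ‖v‖ ^ 2 ≤ ε * ‖v‖ ^ 2 := by gcongr
  linarith

variable {k : ℝ → ℝ → ℝ}

/-- Eigenvectors for `j` of the counted pairs can be chosen orthonormal, and their eigenvalues `1/l`
are at least `1/s`; their span is the subspace. -/
lemma hasFormSubspace_of_le_eigenvalueCount (hS : T.IsSymmetric)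
    (hidx : ∀ l : ℝ, 0 < l →
      index k l = Module.finrank ℂ (eigenspace (T : Module.End ℂ H) ((l⁻¹ : ℝ) : ℂ)))
    {j : ℕ} {s : ℝ} (hj : (j : ℕ∞) ≤ eigenvalueCount k (Set.Ioc 0 s)) :
    HasFormSubspace T j s⁻¹ := by
  classical
  obtain ⟨F, hF, hFj⟩ := Set.exists_subset_encard_eq hj
  have hFfin : F.Finite := Set.finite_of_encard_eq_coe hFj
  have := hFfin.fintype
  have hlt : ∀ p : F, p.1.2 < Module.finrank ℂ
      (eigenspace (T : Module.End ℂ H) ((p.1.1⁻¹ : ℝ) : ℂ)) := fun p => by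
    rw [← hidx _ (hF p.2).1.1]
    exact (hF p.2).2
  have hfd : ∀ p : F, FiniteDimensional ℂ
      (eigenspace (T : Module.End ℂ H) ((p.1.1⁻¹ : ℝ) : ℂ)) := fun p =>
    Module.finite_of_finrank_pos ((Nat.zero_le _).trans_lt (hlt p))
  -- Bases are indexed by all of `ℕ`, with junk value 0 past the dimension, so that a pair `(l, i)`
  -- names a vector directly.
  have hex : ∀ l : ℝ, ∃ b : ℕ → eigenspace (T : Module.End ℂ H) ((l⁻¹ : ℝ) : ℂ),
      FiniteDimensional ℂ (eigenspace (T : Module.End ℂ H) ((l⁻¹ : ℝ) : ℂ)) →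
        ∀ i i', i < Module.finrank ℂ (eigenspace (T : Module.End ℂ H) ((l⁻¹ : ℝ) : ℂ)) →
          i' < Module.finrank ℂ (eigenspace (T : Module.End ℂ H) ((l⁻¹ : ℝ) : ℂ)) →
          inner ℂ (b i) (b i') = if i = i' then (1 : ℂ) else 0 := by
    intro l
    by_cases hl : FiniteDimensional ℂ (eigenspace (T : Module.End ℂ H) ((l⁻¹ : ℝ) : ℂ))
    · let b := stdOrthonormalBasis ℂ (eigenspace (T : Module.End ℂ H) ((l⁻¹ : ℝ) : ℂ))
      refine ⟨fun i => if hi : i < _ then b ⟨i, hi⟩ else 0, fun _ i i' hi hi' => ?_⟩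
      beta_reduce
      rw [dif_pos hi, dif_pos hi', orthonormal_iff_ite.1 b.orthonormal]
      simp [Fin.ext_iff]
    · exact ⟨0, fun h => absurd h hl⟩
  choose b hb using hex
  let e : F → H := fun p => b p.1.1 p.1.2
  have hTe : ∀ p : F, T (e p) = ((p.1.1⁻¹ : ℝ) : ℂ) • e p := fun p =>
    mem_eigenspace_iff.1 (b p.1.1 p.1.2).2
  have hon : Orthonormal ℂ e := by
    rw [orthonormal_iff_ite]
    rintro ⟨⟨l, i⟩, hp⟩ ⟨⟨l', i'⟩, hp'⟩
    by_cases hl : l = l'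
    · subst hl
      have := hb l (hfd ⟨_, hp⟩) i i' (hlt ⟨_, hp⟩) (hlt ⟨_, hp'⟩)
      rw [Submodule.coe_inner] at this
      simp only [e, this, Subtype.mk.injEq, Prod.mk.injEq, true_and]
    · have h1 := hS.orthogonalFamily_eigenspaces
        (show ((l⁻¹ : ℝ) : ℂ) ≠ ((l'⁻¹ : ℝ) : ℂ) by
          rw [Ne, Complex.ofReal_inj, inv_inj]; exact hl) (b l i) (b l' i')
      simp only [e, Subtype.mk.injEq, Prod.mk.injEq, hl, false_and, if_false]
      exact h1
  refine ⟨Submodule.span ℂ (Set.range e), FiniteDimensional.span_of_finite ℂ (Set.finite_range e),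
    ?_, ?_⟩
  · rw [finrank_span_eq_card hon.linearIndependent]
    have : F.encard = (Fintype.card F : ℕ∞) := by
      rw [Set.encard, ENat.card_eq_coe_fintype_card]
    rw [this] at hFj
    exact_mod_cast hFj
  · intro v hv
    obtain ⟨c, rfl⟩ := (Submodule.mem_span_range_iff_exists_fun ℂ).1 hv
    have h1 : T (∑ p, c p • e p) = ∑ p, (c p * ((p.1.1⁻¹ : ℝ) : ℂ)) • e p := by
      rw [map_sum]
      refine Finset.sum_congr rfl fun p _ => ?_
      rw [map_smul, hTe, smul_smul]
    have h2 : ‖∑ p, c p • e p‖ ^ 2 = ∑ p, ‖c p‖ ^ 2 := by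
      have := hon.inner_sum c c Finset.univ
      rw [inner_self_eq_norm_sq_to_K] at this
      have h3 : ∀ p, (starRingEnd ℂ) (c p) * c p = ((‖c p‖ ^ 2 : ℝ) : ℂ) := fun p => by
        rw [mul_comm, Complex.mul_conj, Complex.normSq_eq_norm_sq]
      simp only [h3, Complex.coe_algebraMap] at this
      exact_mod_cast this
    rw [h1, hon.inner_sum, h2, Complex.re_sum, Finset.mul_sum]
    refine Finset.sum_le_sum fun p _ => ?_
    have h3 : (starRingEnd ℂ) (c p * ((p.1.1⁻¹ : ℝ) : ℂ)) * c p
        = ((p.1.1⁻¹ * ‖c p‖ ^ 2 : ℝ) : ℂ) := by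
      rw [map_mul, Complex.conj_ofReal, mul_right_comm, mul_comm ((starRingEnd ℂ) (c p)),
        Complex.mul_conj, Complex.normSq_eq_norm_sq]
      push_cast; ring
    rw [h3, Complex.ofReal_re]
    have hp := (hF p.2).1
    gcongr
    · exact hp.1
    · exact hp.2

/-- Dimension count: were there fewer than `j` eigenvalues, the span `U` of the eigenvectors
concerned would have dimension below `j`, so `V` would contain a nonzero vector orthogonal to `U`.
There the form is at most `s ‖v‖²`, contradicting `s < t`. -/
lemma le_eigenvalueCount_of_hasFormSubspace [CompleteSpace H] (hT : IsCompactOperator T) (hS : T.IsSymmetric)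
    (hidx : ∀ l : ℝ, 0 < l →
      index k l = Module.finrank ℂ (eigenspace (T : Module.End ℂ H) ((l⁻¹ : ℝ) : ℂ)))
    {j : ℕ} {t s : ℝ} (hs : 0 < s) (hst : s < t) (h : HasFormSubspace T j t) :
    (j : ℕ∞) ≤ eigenvalueCount k (Set.Ioc 0 s⁻¹) := by
  classical
  by_contra! hlt
  obtain ⟨V, hV, hVj, hVt⟩ := h
  set P : Set (ℝ × ℕ) := {p | p.1 ∈ Set.Ioc 0 s⁻¹ ∧ p.2 < index k p.1} with hP
  have hfin : P.Finite := Set.finite_of_encard_le_coe hlt.le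
  have := hfin.fintype
  have hcard : Fintype.card P < j := by
    have : P.encard = (Fintype.card P : ℕ∞) := by
      rw [Set.encard, ENat.card_eq_coe_fintype_card]
    rw [eigenvalueCount, ← hP, this] at hlt
    exact_mod_cast hlt
  have hfd : ∀ l : ℝ, 0 < l →
      FiniteDimensional ℂ (eigenspace (T : Module.End ℂ H) ((l⁻¹ : ℝ) : ℂ)) := fun l hl =>
    ContinuousLinearMap.finite_dimensional_eigenspace hT _ (by
      rw [Complex.ofReal_ne_zero]; positivity)
  have hex : ∀ l : ℝ, ∃ b : ℕ → H, 0 < l →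
      eigenspace (T : Module.End ℂ H) ((l⁻¹ : ℝ) : ℂ)
        ≤ Submodule.span ℂ (b '' Set.Iio (index k l)) := by
    intro l
    by_cases hl : 0 < l
    · have := hfd l hl
      let b := Module.finBasis ℂ (eigenspace (T : Module.End ℂ H) ((l⁻¹ : ℝ) : ℂ))
      refine ⟨fun i => if hi : i < _ then (b ⟨i, hi⟩ : H) else 0, fun _ v hv => ?_⟩
      have h1 := b.sum_repr ⟨v, hv⟩
      have h2 : v = ∑ i, b.repr ⟨v, hv⟩ i • (b i : H) := by
        have := congrArg (Submodule.subtype _) h1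
        rw [map_sum] at this
        exact this.symm
      rw [h2]
      refine Submodule.sum_mem _ fun i _ => Submodule.smul_mem _ _ (Submodule.subset_span ?_)
      refine ⟨i, ?_, ?_⟩
      · rw [hidx l hl]; exact i.2
      · simp
    · exact ⟨0, fun h => absurd h hl⟩
  choose b hb using hex
  let e : P → H := fun p => b p.1.1 p.1.2
  let U : Submodule ℂ H := Submodule.span ℂ (Set.range e)
  have : FiniteDimensional ℂ U := FiniteDimensional.span_of_finite ℂ (Set.finite_range e)
  have hUj : Module.finrank ℂ U < Module.finrank ℂ V := by
    rw [hVj]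
    exact (finrank_range_le_card e).trans_lt hcard
  let Q : V →ₗ[ℂ] U := (U.orthogonalProjectionOnto : H →ₗ[ℂ] U).comp V.subtype
  obtain ⟨v, hvker, hv0⟩ := Submodule.exists_mem_ne_zero_of_ne_bot
    (LinearMap.ker_ne_bot_of_finrank_lt (f := Q) hUj)
  have hvU : (v : H) ∈ Uᗮ := by
    rw [← Submodule.orthogonalProjectionOnto_eq_zero_iff]
    exact hvker
  have hle : (inner ℂ (T v) (v : H)).re ≤ s * ‖(v : H)‖ ^ 2 := by
    apply re_inner_le_of_mem_orthogonal_eigenspace hT hS hs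
    intro μ hμ
    have hμ0 : 0 < μ := hs.trans hμ
    have hsub : eigenspace (T : Module.End ℂ H) (μ : ℂ) ≤ U := by
      have h1 := hb μ⁻¹ (by positivity)
      rw [inv_inv] at h1
      refine h1.trans (Submodule.span_mono ?_)
      rintro _ ⟨i, hi, rfl⟩
      have hmem : (μ⁻¹, i) ∈ P :=
        ⟨⟨by positivity, inv_anti₀ hs hμ.le⟩, hi⟩
      exact ⟨⟨(μ⁻¹, i), hmem⟩, rfl⟩
    exact Submodule.orthogonal_le hsub hvU
  have hge := hVt v v.2
  have hvpos : 0 < ‖(v : H)‖ ^ 2 := by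
    have : (v : H) ≠ 0 := by simpa using hv0
    positivity
  nlinarith

lemma nuPos_nonneg (k : ℝ → ℝ → ℝ) (j : ℕ) : 0 ≤ nuPos k j := by
  unfold nuPos
  split_ifs
  · exact one_div_nonneg.2 (Real.sInf_nonneg fun t ht => ht.1.le)
  · exact le_rfl

lemma eigenvalueCount_mono (k : ℝ → ℝ → ℝ) {S S' : Set ℝ} (h : S ⊆ S') :
    eigenvalueCount k S ≤ eigenvalueCount k S' :=
  Set.encard_le_encard fun _ hp => ⟨h hp.1, hp.2⟩

lemma le_nuPos_of_hasFormSubspace [CompleteSpace H] (hT : IsCompactOperator T) (hS : T.IsSymmetric)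
    (hidx : ∀ l : ℝ, 0 < l →
      index k l = Module.finrank ℂ (eigenspace (T : Module.End ℂ H) ((l⁻¹ : ℝ) : ℂ)))
    {j : ℕ} (hj : 1 ≤ j) {t : ℝ} (h : HasFormSubspace T j t) : t ≤ nuPos k j := by
  refine le_of_forall_lt_imp_le_of_dense fun s hst => ?_
  rcases le_or_gt s 0 with hs | hs
  · exact hs.trans (nuPos_nonneg k j)
  have hmem := le_eigenvalueCount_of_hasFormSubspace hT hS hidx hs hst h
  have hTpos : 0 < ‖T‖ := (hs.trans hst).trans_le (h.le_norm hj)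
  have hcount : (j : ℕ∞) ≤ eigenvalueCount k (Set.Ioi 0) :=
    hmem.trans (eigenvalueCount_mono k fun _ hx => hx.1)
  rw [nuPos, if_pos hcount]
  set A := {t : ℝ | 0 < t ∧ (j : ℕ∞) ≤ eigenvalueCount k (Set.Ioc 0 t)} with hA
  have hsA : s⁻¹ ∈ A := ⟨by positivity, hmem⟩
  -- This keeps `sInf A` away from 0, where the convention `1 / 0 = 0` would spoil the conclusion.
  have hlow : ∀ a ∈ A, ‖T‖⁻¹ ≤ a := fun a ha =>
    inv_le_of_inv_le₀ ha.1 ((hasFormSubspace_of_le_eigenvalueCount hS hidx ha.2).le_norm hj)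
  have h1 : sInf A ≤ s⁻¹ := csInf_le ⟨_, hlow⟩ hsA
  have h2 : ‖T‖⁻¹ ≤ sInf A := le_csInf ⟨_, hsA⟩ hlow
  have h3 : 0 < sInf A := lt_of_lt_of_le (by positivity) h2
  rw [one_div]
  exact (le_inv_comm₀ h3 hs).1 h1

lemma hasFormSubspace_of_lt_nuPos (hS : T.IsSymmetric)
    (hidx : ∀ l : ℝ, 0 < l →
      index k l = Module.finrank ℂ (eigenspace (T : Module.End ℂ H) ((l⁻¹ : ℝ) : ℂ)))
    {j : ℕ} {t : ℝ} (ht : 0 < t) (h : t < nuPos k j) : HasFormSubspace T j t := by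
  unfold nuPos at h
  split_ifs at h with hc
  swap
  · linarith
  set A := {t : ℝ | 0 < t ∧ (j : ℕ∞) ≤ eigenvalueCount k (Set.Ioc 0 t)} with hA
  -- For empty `A` the conventions `sInf ∅ = 0` and `1 / 0 = 0` would give `t < 0`.
  have hne : A.Nonempty := by
    by_contra hne
    rw [Set.not_nonempty_iff_eq_empty.1 hne, Real.sInf_empty] at h
    simp at h
    linarith
  have hpos : 0 < sInf A := by
    by_contra hle
    have : 1 / sInf A ≤ 0 := one_div_nonpos.2 (not_lt.1 hle)
    linarith
  obtain ⟨s, hsA, hs⟩ := exists_lt_of_csInf_lt hne ((lt_inv_comm₀ ht hpos).1 (one_div (sInf A) ▸ h))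
  exact (hasFormSubspace_of_le_eigenvalueCount hS hidx hsA.2).mono
    ((lt_inv_comm₀ hsA.1 ht).1 hs).le

/-- One half of Weyl's inequality: a form subspace for `T` at level `t` is one for `T'` at level `t
- ε`. -/
lemma nuPos_le_add [CompleteSpace H] {k' : ℝ → ℝ → ℝ} {T' : H →L[ℂ] H} (hS : T.IsSymmetric)
    (hidx : ∀ l : ℝ, 0 < l →
      index k l = Module.finrank ℂ (eigenspace (T : Module.End ℂ H) ((l⁻¹ : ℝ) : ℂ)))
    (hT' : IsCompactOperator T') (hS' : T'.IsSymmetric)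
    (hidx' : ∀ l : ℝ, 0 < l →
      index k' l = Module.finrank ℂ (eigenspace (T' : Module.End ℂ H) ((l⁻¹ : ℝ) : ℂ)))
    {j : ℕ} (hj : 1 ≤ j) {ε : ℝ} (hε : ‖T - T'‖ ≤ ε) : nuPos k j ≤ nuPos k' j + ε := by
  by_contra! hlt
  obtain ⟨t, ht1, ht2⟩ := exists_between hlt
  have hε0 : 0 ≤ ε := (norm_nonneg _).trans hε
  have ht0 : 0 < t := lt_of_le_of_lt (add_nonneg (nuPos_nonneg k' j) hε0) ht1
  have := le_nuPos_of_hasFormSubspace hT' hS' hidx' hj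
    ((hasFormSubspace_of_lt_nuPos hS hidx ht0 ht2).sub hε)
  linarith

end Spectral

end

/-! ### Integral operators on `L²([0,1])` with bounded kernels. -/

section

/-- A measurable kernel with values in `[-1, 1]`. -/
structure IsUnitKernel (k : ℝ → ℝ → ℝ) : Prop where
  measurable : Measurable (Function.uncurry k)
  abs_le_one : ∀ x y, |k x y| ≤ 1

/-- The function `x ↦ ∫₀¹ k(x,y) f(y) dy`. -/
noncomputable def kernelIntegral (k : ℝ → ℝ → ℝ) (f : unitInterval → ℂ) (x : unitInterval) : ℂ :=
  ∫ y : unitInterval, (k x y : ℂ) * f y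

variable {k k' : ℝ → ℝ → ℝ} {f g : unitInterval → ℂ}

lemma kernelIntegral_congr_ae (h : f =ᵐ[volume] g) : kernelIntegral k f = kernelIntegral k g := by
  ext x
  apply integral_congr_ae
  filter_upwards [h] with y hy
  rw [hy]

namespace IsUnitKernel

lemma measurable_coe (hk : IsUnitKernel k) :
    Measurable fun p : unitInterval × unitInterval => (k p.1 p.2 : ℂ) := by
  have h : Measurable fun p : unitInterval × unitInterval => k p.1 p.2 :=
    hk.measurable.comp (g := Function.uncurry k)
      (f := fun p : unitInterval × unitInterval => ((p.1 : ℝ), (p.2 : ℝ)))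
      ((measurable_subtype_coe.comp measurable_fst).prodMk
        (measurable_subtype_coe.comp measurable_snd))
  exact Complex.measurable_ofReal.comp h

lemma measurable_coe_right (hk : IsUnitKernel k) (x : unitInterval) :
    Measurable fun y : unitInterval => (k x y : ℂ) :=
  hk.measurable_coe.comp measurable_prodMk_left

lemma norm_coe_le_one (hk : IsUnitKernel k) (x y : ℝ) : ‖(k x y : ℂ)‖ ≤ 1 := by
  rw [Complex.norm_real]; exact hk.abs_le_one x y

lemma integrable_mul (hk : IsUnitKernel k) (hf : MemLp f 2 volume) (x : unitInterval) :
    Integrable (fun y : unitInterval => (k x y : ℂ) * f y) volume :=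
  (hf.integrable one_le_two).bdd_mul (c := 1) (hk.measurable_coe_right x).aestronglyMeasurable
    (Filter.Eventually.of_forall fun y => hk.norm_coe_le_one x y)

/-- Cauchy–Schwarz in `y`; integrating over `x` then bounds the operator norm by the Hilbert–Schmidt
norm. -/
lemma enorm_kernelIntegral_sq_le (hk : IsUnitKernel k) (hf : AEStronglyMeasurable f volume)
    (x : unitInterval) :
    ‖kernelIntegral k f x‖ₑ ^ 2
      ≤ (∫⁻ y : unitInterval, ENNReal.ofReal (k x y ^ 2)) * ∫⁻ y, ‖f y‖ₑ ^ 2 := by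
  have h1 : ‖kernelIntegral k f x‖ₑ ≤ ∫⁻ y : unitInterval, ‖(k x y : ℂ)‖ₑ * ‖f y‖ₑ := by
    refine (enorm_integral_le_lintegral_enorm _).trans (le_of_eq ?_)
    simp only [enorm_mul]
  have h2 := ENNReal.lintegral_mul_le_Lp_mul_Lq volume Real.HolderConjugate.two_two
    (hk.measurable_coe_right x).enorm.aemeasurable hf.enorm
  have h3 : ∀ y : unitInterval, ‖(k x y : ℂ)‖ₑ ^ (2 : ℝ) = ENNReal.ofReal (k x y ^ 2) := by
    intro y
    rw [← ofReal_norm, Complex.norm_real, ENNReal.rpow_two,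
      ← ENNReal.ofReal_pow (norm_nonneg _), Real.norm_eq_abs, sq_abs]
  have h4 : ∀ a : ENNReal, (a ^ (1 / 2 : ℝ)) ^ 2 = a := fun a => by
    rw [← ENNReal.rpow_two, ← ENNReal.rpow_mul]; norm_num
  calc ‖kernelIntegral k f x‖ₑ ^ 2 ≤ _ := pow_le_pow_left₀ zero_le (h1.trans h2) 2
    _ = _ := by simp only [mul_pow, h4, h3, ENNReal.rpow_two]

lemma aestronglyMeasurable_kernelIntegral (hk : IsUnitKernel k)
    (hf : AEStronglyMeasurable f volume) :
    AEStronglyMeasurable (kernelIntegral k f) volume := by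
  rw [kernelIntegral_congr_ae hf.ae_eq_mk]
  have : StronglyMeasurable fun p : unitInterval × unitInterval => (k p.1 p.2 : ℂ) * hf.mk f p.2 :=
    hk.measurable_coe.stronglyMeasurable.mul
      (hf.stronglyMeasurable_mk.comp_measurable measurable_snd)
  exact this.integral_prod_right'.aestronglyMeasurable

lemma eLpNorm_kernelIntegral_le (hk : IsUnitKernel k) (hf : AEStronglyMeasurable f volume) {C : ℝ}
    (hC : 0 ≤ C)
    (h : ∫⁻ x : unitInterval, ∫⁻ y : unitInterval, ENNReal.ofReal (k x y ^ 2) ≤ ENNReal.ofReal C) :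
    eLpNorm (kernelIntegral k f) 2 volume ≤ ENNReal.ofReal √C * eLpNorm f 2 volume := by
  have e : ∀ u : unitInterval → ℂ, eLpNorm u 2 volume ^ 2 = ∫⁻ y, ‖u y‖ₑ ^ 2 := fun u => by
    have := eLpNorm_nnreal_pow_eq_lintegral (f := u) (μ := volume) (p := 2) two_ne_zero
    simpa using this
  rw [← ENNReal.pow_le_pow_left_iff two_ne_zero, mul_pow, e, e,
    ← ENNReal.ofReal_pow (Real.sqrt_nonneg _), Real.sq_sqrt hC]
  have hm : Measurable fun x : unitInterval => ∫⁻ y : unitInterval, ENNReal.ofReal (k x y ^ 2) := by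
    have : Measurable fun p : unitInterval × unitInterval => ENNReal.ofReal (k p.1 p.2 ^ 2) := by
      have h := (Complex.measurable_re.comp hk.measurable_coe)
      exact (h.pow_const 2).ennreal_ofReal
    exact this.lintegral_prod_right'
  calc _ ≤ ∫⁻ x : unitInterval,
        (∫⁻ y : unitInterval, ENNReal.ofReal (k x y ^ 2)) * ∫⁻ y, ‖f y‖ₑ ^ 2 :=
        lintegral_mono fun x => hk.enorm_kernelIntegral_sq_le hf x
    _ = (∫⁻ x : unitInterval, ∫⁻ y : unitInterval, ENNReal.ofReal (k x y ^ 2))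
          * ∫⁻ y, ‖f y‖ₑ ^ 2 := lintegral_mul_const _ hm
    _ ≤ _ := by gcongr

lemma lintegral_sq_le_one (hk : IsUnitKernel k) :
    ∫⁻ x : unitInterval, ∫⁻ y : unitInterval, ENNReal.ofReal (k x y ^ 2) ≤ ENNReal.ofReal 1 := by
  calc _ ≤ ∫⁻ _ : unitInterval, ∫⁻ _ : unitInterval, ENNReal.ofReal 1 := by
        refine lintegral_mono fun x => lintegral_mono fun y => ENNReal.ofReal_le_ofReal ?_
        rw [sq_le_one_iff_abs_le_one]
        exact hk.abs_le_one x y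
    _ = _ := by simp

lemma memLp_kernelIntegral (hk : IsUnitKernel k) (hf : MemLp f 2 volume) :
    MemLp (kernelIntegral k f) 2 volume :=
  ⟨hk.aestronglyMeasurable_kernelIntegral hf.1,
    (hk.eLpNorm_kernelIntegral_le hf.1 zero_le_one hk.lintegral_sq_le_one).trans_lt
      (ENNReal.mul_lt_top ENNReal.ofReal_lt_top hf.2)⟩

/-- The integral operator on `L²([0,1])` with kernel `k`. -/
noncomputable def op (hk : IsUnitKernel k) :
    Lp ℂ 2 (volume : Measure unitInterval) →L[ℂ] Lp ℂ 2 (volume : Measure unitInterval) :=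
  LinearMap.mkContinuous
    { toFun := fun f => (hk.memLp_kernelIntegral (Lp.memLp f)).toLp _
      map_add' := fun f g => by
        rw [← MemLp.toLp_add]
        congr 1
        rw [kernelIntegral_congr_ae (Lp.coeFn_add f g)]
        ext x
        simp only [kernelIntegral, Pi.add_apply, mul_add]
        exact integral_add (hk.integrable_mul (Lp.memLp f) x) (hk.integrable_mul (Lp.memLp g) x)
      map_smul' := fun c f => by
        rw [RingHom.id_apply, ← MemLp.toLp_const_smul]
        congr 1
        rw [kernelIntegral_congr_ae (Lp.coeFn_smul c f)]
        ext x
        simp only [kernelIntegral, Pi.smul_apply, smul_eq_mul, mul_left_comm _ c]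
        exact integral_const_mul _ _ } 1 (fun f => by
      have h := hk.eLpNorm_kernelIntegral_le (Lp.aestronglyMeasurable f) zero_le_one
        hk.lintegral_sq_le_one
      rw [Real.sqrt_one, ENNReal.ofReal_one, one_mul] at h
      rw [one_mul, Lp.norm_def f]
      change ‖(hk.memLp_kernelIntegral (Lp.memLp f)).toLp _‖ ≤ _
      rw [Lp.norm_toLp]
      exact ENNReal.toReal_mono (Lp.eLpNorm_ne_top f) h)

lemma op_apply (hk : IsUnitKernel k) (f : Lp ℂ 2 (volume : Measure unitInterval)) :
    hk.op f = (hk.memLp_kernelIntegral (Lp.memLp f)).toLp (kernelIntegral k f) := rfl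

lemma coeFn_op (hk : IsUnitKernel k) (f : Lp ℂ 2 (volume : Measure unitInterval)) :
    hk.op f =ᵐ[volume] kernelIntegral k f := by
  rw [op_apply]
  exact MemLp.coeFn_toLp _

lemma norm_op_le (hk : IsUnitKernel k) {C : ℝ}
    (h : ∫⁻ x : unitInterval, ∫⁻ y : unitInterval, ENNReal.ofReal (k x y ^ 2) ≤ ENNReal.ofReal C) :
    ‖hk.op‖ ≤ √C := by
  wlog hC : 0 ≤ C generalizing C
  · rw [Real.sqrt_eq_zero_of_nonpos (not_le.1 hC).le, ← Real.sqrt_zero]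
    refine this (h.trans (le_of_eq ?_)) le_rfl
    rw [ENNReal.ofReal_of_nonpos (not_le.1 hC).le, ENNReal.ofReal_zero]
  refine ContinuousLinearMap.opNorm_le_bound _ (Real.sqrt_nonneg _) fun f => ?_
  rw [op_apply, Lp.norm_toLp, Lp.norm_def f, ← ENNReal.toReal_ofReal (Real.sqrt_nonneg C),
    ← ENNReal.toReal_mul]
  exact ENNReal.toReal_mono (ENNReal.mul_ne_top ENNReal.ofReal_ne_top (Lp.eLpNorm_ne_top f))
    (hk.eLpNorm_kernelIntegral_le (Lp.aestronglyMeasurable f) hC h)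

lemma op_sub (hk : IsUnitKernel k) (hk' : IsUnitKernel k')
    (hs : IsUnitKernel fun x y => k x y - k' x y) : hk.op - hk'.op = hs.op := by
  ext1 f
  rw [_root_.sub_apply, op_apply, op_apply, op_apply, ← MemLp.toLp_sub]
  congr 1
  ext x
  simp only [kernelIntegral, Pi.sub_apply, Complex.ofReal_sub, sub_mul]
  exact (integral_sub (hk.integrable_mul (Lp.memLp f) x) (hk'.integrable_mul (Lp.memLp f) x)).symm

lemma isSymmetric_op (hk : IsUnitKernel k) (hsymm : ∀ x y, k x y = k y x) :
    (hk.op : Lp ℂ 2 (volume : Measure unitInterval) →L[ℂ] _).IsSymmetric := by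
  intro f g
  change inner ℂ (hk.op f) g = inner ℂ f (hk.op g)
  rw [L2.inner_def, L2.inner_def]
  have hf := (Lp.memLp f).integrable one_le_two
  have hg := (Lp.memLp g).integrable one_le_two
  have hfc : Integrable (fun y => (starRingEnd ℂ) (f y)) volume :=
    (LinearIsometryEquiv.integrable_comp_iff (Complex.conjLIE)).2 hf
  let F : unitInterval → unitInterval → ℂ := fun x y => (k x y : ℂ) * (g x * (starRingEnd ℂ) (f y))
  have hF : Integrable (Function.uncurry F) (volume.prod volume) :=
    (hg.mul_prod hfc).bdd_mul (c := 1) hk.measurable_coe.aestronglyMeasurable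
      (Filter.Eventually.of_forall fun p => hk.norm_coe_le_one p.1 p.2)
  have h1 : ∫ x, inner ℂ (hk.op f x) (g x) = ∫ x, ∫ y, F x y := by
    apply integral_congr_ae
    filter_upwards [hk.coeFn_op f] with x hx
    rw [hx, RCLike.inner_apply, kernelIntegral, ← integral_conj, ← integral_const_mul]
    refine integral_congr_ae (Filter.Eventually.of_forall fun y => ?_)
    simp only [map_mul, Complex.conj_ofReal, F]
    ring
  have h2 : ∫ x, inner ℂ (f x) (hk.op g x) = ∫ y, ∫ x, F x y := by
    apply integral_congr_ae
    filter_upwards [hk.coeFn_op g] with x hx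
    rw [hx, RCLike.inner_apply, kernelIntegral, ← integral_mul_const]
    refine integral_congr_ae (Filter.Eventually.of_forall fun y => ?_)
    simp only [F, hsymm x y]
    ring
  rw [h1, h2]
  exact integral_integral_swap hF

/-- Eigenfunctions of a kernel are, up to null sets, the eigenvectors of its operator. -/
lemma index_eq (hk : IsUnitKernel k) {l : ℝ} (hl : l ≠ 0) :
    index k l = Module.finrank ℂ (eigenspace
      (hk.op : Module.End ℂ (Lp ℂ 2 (volume : Measure unitInterval))) ((l⁻¹ : ℝ) : ℂ)) := by
  have hl' : (l : ℂ) ≠ 0 := by exact_mod_cast hl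
  let Φ : kernelEigenspace k l →ₗ[ℂ] eigenspace
      (hk.op : Module.End ℂ (Lp ℂ 2 (volume : Measure unitInterval))) ((l⁻¹ : ℝ) : ℂ) :=
    { toFun := fun φ => ⟨φ.2.1.toLp φ.1, by
        rw [mem_eigenspace_iff]
        change hk.op _ = _
        rw [op_apply, ← MemLp.toLp_const_smul]
        congr 1
        rw [kernelIntegral_congr_ae φ.2.1.coeFn_toLp]
        ext x
        rw [Pi.smul_apply, (φ.2.2 x).2, smul_eq_mul, Complex.ofReal_inv, inv_mul_cancel_left₀ hl']
        rfl⟩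
      map_add' := fun φ ψ => rfl
      map_smul' := fun c φ => rfl }
  refine LinearEquiv.finrank_eq (LinearEquiv.ofBijective Φ ⟨?_, ?_⟩)
  · rw [← LinearMap.ker_eq_bot, LinearMap.ker_eq_bot']
    intro φ hφ
    have h0 : φ.2.1.toLp φ.1 = 0 := congrArg Subtype.val hφ
    have h0 : φ.1 =ᵐ[volume] 0 := by
      have h1 := φ.2.1.coeFn_toLp
      rw [h0] at h1
      exact h1.symm.trans (Lp.coeFn_zero ℂ 2 volume)
    apply Subtype.ext
    ext x
    rw [(φ.2.2 x).2]
    have := congrFun (kernelIntegral_congr_ae (k := k) h0) x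
    simp only [kernelIntegral, Pi.zero_apply, mul_zero, integral_zero] at this
    rw [this, mul_zero]
    rfl
  · rintro ⟨ψ, hψ⟩
    rw [mem_eigenspace_iff] at hψ
    -- The right side depends only on the class of `ψ` and is defined at every point, so it is the
    -- representative that solves the equation everywhere.
    have hae : (ψ : unitInterval → ℂ) =ᵐ[volume] (l : ℂ) • kernelIntegral k ψ := by
      have h1 := hk.coeFn_op ψ
      have h2 : hk.op ψ = ((l⁻¹ : ℝ) : ℂ) • ψ := hψ
      rw [h2] at h1
      filter_upwards [h1, Lp.coeFn_smul ((l⁻¹ : ℝ) : ℂ) ψ] with x hx1 hx2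
      rw [Pi.smul_apply, ← hx1, hx2, Pi.smul_apply, smul_smul, Complex.ofReal_inv,
        mul_inv_cancel₀ hl', one_smul]
    have hm : MemLp ((l : ℂ) • kernelIntegral k ψ) 2 volume :=
      (hk.memLp_kernelIntegral (Lp.memLp ψ)).const_smul _
    refine ⟨⟨(l : ℂ) • kernelIntegral k ψ, hm, fun x => ⟨hk.integrable_mul hm x, ?_⟩⟩, ?_⟩
    · rw [Pi.smul_apply, smul_eq_mul]
      congr 1
      exact congrFun (kernelIntegral_congr_ae hae) x
    · apply Subtype.ext
      apply Lp.ext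
      exact hm.coeFn_toLp.trans hae.symm

end IsUnitKernel

end

/-! ### The step kernel as a finite-rank operator and its matrix. -/

section

variable {N : ℕ}

/-- The `i`-th of the `N` cells `(i / N, (i + 1) / N]` of the unit interval. -/
def cell (N : ℕ) (i : Fin N) : Set ℝ := Set.Ioc ((i : ℝ) / N) ((i + 1 : ℝ) / N)

/-- The indicator function of a cell. -/
noncomputable def cellFun (N : ℕ) (i : Fin N) (x : unitInterval) : ℂ :=
  (cell N i).indicator 1 (x : ℝ)

lemma mem_cell_iff (hN : 0 < N) {i : Fin N} {x : ℝ} :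
    x ∈ cell N i ↔ ⌈(N : ℝ) * x⌉ = (i : ℤ) + 1 := by
  have h : (0 : ℝ) < N := by exact_mod_cast hN
  rw [Int.ceil_eq_iff, cell, Set.mem_Ioc, div_lt_iff₀' h, le_div_iff₀' h]
  push_cast
  rw [add_sub_cancel_right]

lemma exists_mem_cell (hN : 0 < N) {x : ℝ} (hx : 0 < x) (hx1 : x ≤ 1) : ∃ i, x ∈ cell N i := by
  have h : (0 : ℝ) < N := by exact_mod_cast hN
  have h0 : 0 < ⌈(N : ℝ) * x⌉ := Int.ceil_pos.2 (by positivity)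
  have h1 : ⌈(N : ℝ) * x⌉ ≤ N := Int.ceil_le.2 (by push_cast; nlinarith)
  refine ⟨⟨(⌈(N : ℝ) * x⌉ - 1).toNat, by omega⟩, ?_⟩
  rw [mem_cell_iff hN]
  simp only
  omega

lemma cell_eq_of_mem (hN : 0 < N) {i j : Fin N} {x : ℝ} (hi : x ∈ cell N i) (hj : x ∈ cell N j) :
    i = j := by
  rw [mem_cell_iff hN] at hi hj
  ext
  omega

lemma not_mem_cell_zero (i : Fin N) : (0 : ℝ) ∉ cell N i := fun h => by
  have : (0 : ℝ) ≤ (i : ℝ) / N := by positivity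
  exact absurd h.1 (not_lt.2 this)

lemma cellFun_of_mem (hN : 0 < N) {i : Fin N} {x : unitInterval} (hi : (x : ℝ) ∈ cell N i)
    (j : Fin N) : cellFun N j x = if j = i then 1 else 0 := by
  unfold cellFun
  split_ifs with h
  · rw [h, Set.indicator_of_mem hi, Pi.one_apply]
  · rw [Set.indicator_of_notMem fun hj => h (cell_eq_of_mem hN hj hi)]

lemma cellFun_zero {x : unitInterval} (hx : (x : ℝ) = 0) (i : Fin N) : cellFun N i x = 0 := by
  rw [cellFun, hx, Set.indicator_of_notMem (not_mem_cell_zero i)]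

lemma stepKernel_eq_matrixZ (hN : 0 < N) {i j : Fin N} {x y : ℝ} (hx : x ∈ cell N i)
    (hy : y ∈ cell N j) : stepKernel N x y = matrixZ N i j := by
  have h : (N : ℝ) ≠ 0 := by exact_mod_cast hN.ne'
  have hx0 : x ≠ 0 := fun h => not_mem_cell_zero i (h ▸ hx)
  have hy0 : y ≠ 0 := fun h => not_mem_cell_zero j (h ▸ hy)
  have hi : ((i : ℕ) + 1 : ℝ) / N ≠ 0 := by positivity
  have hj : ((j : ℕ) + 1 : ℝ) / N ≠ 0 := by positivity
  rw [matrixZ, Matrix.of_apply, kernelK_eq hi hj, stepKernel_eq hN hx0 hy0, roundUp, roundUp,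
    (mem_cell_iff hN).1 hx, (mem_cell_iff hN).1 hy]
  push_cast
  rfl

/-- The cells partition `(0,1]` and miss 0, where the kernel vanishes too; hence the identity holds
at every point and not just almost everywhere. -/
lemma stepKernel_eq_sum (hN : 0 < N) (x y : unitInterval) :
    (stepKernel N x y : ℂ) = ∑ i, cellFun N i x * ∑ j, (matrixZ N i j : ℂ) * cellFun N j y := by
  rcases x.2.1.eq_or_lt with hx | hx
  · simp [cellFun_zero hx.symm, stepKernel, hx.symm]
  rcases y.2.1.eq_or_lt with hy | hy
  · simp [cellFun_zero hy.symm, stepKernel, hy.symm]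
  obtain ⟨i, hi⟩ := exists_mem_cell hN hx x.2.2
  obtain ⟨j, hj⟩ := exists_mem_cell hN hy y.2.2
  simp [cellFun_of_mem hN hi, cellFun_of_mem hN hj, stepKernel_eq_matrixZ hN hi hj]

lemma measurable_cellFun (i : Fin N) : Measurable (cellFun N i) :=
  (measurable_one.indicator measurableSet_Ioc).comp measurable_subtype_coe

lemma norm_cellFun_le (i : Fin N) (x : unitInterval) : ‖cellFun N i x‖ ≤ 1 := by
  unfold cellFun
  exact (norm_indicator_le_norm_self _ _).trans (by simp)

lemma memLp_cellFun (i : Fin N) : MemLp (cellFun N i) 2 volume :=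
  MemLp.of_bound (measurable_cellFun i).aestronglyMeasurable 1
    (Filter.Eventually.of_forall (norm_cellFun_le i))

lemma integrable_cellFun_mul {f : unitInterval → ℂ} (hf : MemLp f 2 volume) (i : Fin N) :
    Integrable (fun y => cellFun N i y * f y) volume :=
  (hf.integrable one_le_two).bdd_mul (c := 1) (measurable_cellFun i).aestronglyMeasurable
    (Filter.Eventually.of_forall (norm_cellFun_le i))

lemma integral_cellFun (hN : 0 < N) (i : Fin N) : ∫ y, cellFun N i y = (N : ℂ)⁻¹ := by
  have h : (0 : ℝ) < N := by exact_mod_cast hN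
  have hsub : cell N i ⊆ Set.Icc 0 1 := by
    refine fun x hx => ⟨le_trans (by positivity) hx.1.le, hx.2.trans ?_⟩
    rw [div_le_one h]
    exact_mod_cast i.2
  have h1 : ∫ y, cellFun N i y = ∫ y in Set.Icc (0 : ℝ) 1, (cell N i).indicator (1 : ℝ → ℂ) y :=
    integral_subtype_comap measurableSet_Icc fun y => (cell N i).indicator (1 : ℝ → ℂ) y
  rw [h1, setIntegral_indicator (show MeasurableSet (cell N i) from measurableSet_Ioc), Set.inter_eq_right.2 hsub]
  simp only [Pi.one_apply, setIntegral_const, cell, Real.volume_real_Ioc]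
  rw [max_eq_left (by rw [← sub_div]; simp), ← sub_div]
  simp

lemma integral_cellFun_mul_sum (hN : 0 < N) (c : Fin N → ℂ) (j : Fin N) :
    ∫ y, cellFun N j y * ∑ i, c i * cellFun N i y = (N : ℂ)⁻¹ * c j := by
  have : ∀ y, cellFun N j y * ∑ i, c i * cellFun N i y = cellFun N j y * c j := by
    intro y
    by_cases hy : (y : ℝ) ∈ cell N j
    · simp [cellFun_of_mem hN hy]
    · have : cellFun N j y = 0 := by rw [cellFun, Set.indicator_of_notMem hy]
      rw [this, zero_mul, zero_mul]
  simp only [this]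
  rw [integral_mul_const, integral_cellFun hN]

lemma kernelIntegral_stepKernel (hN : 0 < N) {f : unitInterval → ℂ} (hf : MemLp f 2 volume)
    (x : unitInterval) :
    kernelIntegral (stepKernel N) f x
      = ∑ i, (∑ j, (matrixZ N i j : ℂ) * ∫ y, cellFun N j y * f y) * cellFun N i x := by
  have h1 : ∀ y : unitInterval, (stepKernel N x y : ℂ) * f y
      = ∑ i, ∑ j, (cellFun N i x * (matrixZ N i j : ℂ)) * (cellFun N j y * f y) := by
    intro y
    rw [stepKernel_eq_sum hN, Finset.sum_mul]
    refine Finset.sum_congr rfl fun i _ => ?_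
    rw [Finset.mul_sum, Finset.sum_mul]
    refine Finset.sum_congr rfl fun j _ => ?_
    ring
  rw [kernelIntegral]
  simp only [h1]
  rw [integral_finsetSum _ fun i _ => integrable_finsetSum _ fun j _ =>
    (integrable_cellFun_mul hf j).const_mul _]
  refine Finset.sum_congr rfl fun i _ => ?_
  rw [integral_finsetSum _ fun j _ => (integrable_cellFun_mul hf j).const_mul _, Finset.sum_mul]
  refine Finset.sum_congr rfl fun j _ => ?_
  rw [integral_const_mul]
  ring

lemma isUnitKernel_stepKernel : IsUnitKernel (stepKernel N) :=
  ⟨measurable_stepKernel, fun x y => (abs_stepKernel_le x y).trans (by norm_num)⟩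

lemma isUnitKernel_kernelK : IsUnitKernel kernelK :=
  ⟨measurable_kernelK, fun x y => (abs_kernelK_le x y).trans (by norm_num)⟩

lemma isUnitKernel_sub : IsUnitKernel fun x y => kernelK x y - stepKernel N x y :=
  ⟨measurable_kernelK.sub measurable_stepKernel, fun x y => (abs_sub _ _).trans (by
    linarith [abs_kernelK_le x y, abs_stepKernel_le (N := N) x y])⟩

lemma isCompactOperator_of_mem_finiteDimensional {H : Type*} [NormedAddCommGroup H]
    [NormedSpace ℂ H] {T : H →L[ℂ] H} (U : Submodule ℂ H) [FiniteDimensional ℂ U]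
    (h : ∀ f, T f ∈ U) : IsCompactOperator T := by
  have : ProperSpace U := FiniteDimensional.proper ℂ U
  have hc : IsCompactOperator (T.codRestrict U h) :=
    isCompactOperator_of_locallyCompactSpace_dom (T.codRestrict U h)
  exact hc.clm_comp U.subtypeL

lemma isCompactOperator_op_stepKernel (hN : 0 < N) :
    IsCompactOperator (isUnitKernel_stepKernel (N := N)).op := by
  have : FiniteDimensional ℂ (Submodule.span ℂ
      (Set.range fun i : Fin N => (memLp_cellFun i).toLp (cellFun N i))) :=
    FiniteDimensional.span_of_finite ℂ (Set.finite_range _)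
  refine isCompactOperator_of_mem_finiteDimensional (Submodule.span ℂ
      (Set.range fun i : Fin N => (memLp_cellFun i).toLp (cellFun N i))) fun f => ?_
  rw [Submodule.mem_span_range_iff_exists_fun]
  refine ⟨fun i => ∑ j, (matrixZ N i j : ℂ) * ∫ y, cellFun N j y * f y, ?_⟩
  apply Lp.ext
  refine (Lp.coeFn_finsetSum _ _).trans (Filter.EventuallyEq.trans ?_
    (isUnitKernel_stepKernel.coeFn_op f).symm)
  have hae : ∀ᵐ x, ∀ i : Fin N, ((∑ j, (matrixZ N i j : ℂ) * ∫ y, cellFun N j y * f y)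
      • (memLp_cellFun i).toLp (cellFun N i) : Lp ℂ 2 volume) x
      = (∑ j, (matrixZ N i j : ℂ) * ∫ y, cellFun N j y * f y) * cellFun N i x := by
    rw [ae_all_iff]
    intro i
    filter_upwards [Lp.coeFn_smul (∑ j, (matrixZ N i j : ℂ) * ∫ y, cellFun N j y * f y)
      ((memLp_cellFun i).toLp (cellFun N i)), (memLp_cellFun i).coeFn_toLp] with x h1 h2
    rw [h1, Pi.smul_apply, h2, smul_eq_mul]
  filter_upwards [hae] with x hx
  rw [kernelIntegral_stepKernel hN (Lp.memLp f), Finset.sum_apply]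
  exact Finset.sum_congr rfl fun i _ => hx i

lemma norm_op_sub_le (hN : 25 ≤ N) :
    ‖isUnitKernel_kernelK.op - (isUnitKernel_stepKernel (N := N)).op‖ ≤ √(hsBound N) := by
  rw [IsUnitKernel.op_sub _ _ isUnitKernel_sub]
  exact isUnitKernel_sub.norm_op_le (lintegral_unitInterval_sq_kernel_sub_le hN)

/-- A norm limit of finite-rank operators, since the Hilbert–Schmidt distance to the step kernels
tends to 0. -/
lemma isCompactOperator_op_kernelK : IsCompactOperator isUnitKernel_kernelK.op := by
  refine isCompactOperator_of_tendsto (l := Filter.atTop)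
    (F := fun N : ℕ => (isUnitKernel_stepKernel (N := N)).op) ?_ ?_
  · rw [tendsto_iff_norm_sub_tendsto_zero]
    have h := tendsto_hsBound.sqrt
    rw [Real.sqrt_zero] at h
    refine squeeze_zero' (Filter.Eventually.of_forall fun _ => norm_nonneg _) ?_ h
    filter_upwards [Filter.eventually_ge_atTop 25] with N hN
    rw [norm_sub_rev]
    exact (norm_op_sub_le hN).trans (Real.sqrt_le_sqrt (hsBound_le hN))
  · filter_upwards [Filter.eventually_gt_atTop 0] with N hN using isCompactOperator_op_stepKernel hN

/-- The isomorphism sends `c` to the step function with value `c i` on cell `i`. Integration over a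
cell contributes `1/N`, which turns `c = (l/N) Z c` into the eigenvalue `N/l`. -/
lemma index_stepKernel (hN : 0 < N) {l : ℝ} (hl : l ≠ 0) :
    index (stepKernel N) l = Module.finrank ℂ (eigenspace
      (Matrix.toLin' ((matrixZ N).map (fun a : ℝ => (a : ℂ)))) (((N : ℝ) / l : ℝ) : ℂ)) := by
  have hl' : (l : ℂ) ≠ 0 := by exact_mod_cast hl
  have hN' : (N : ℂ) ≠ 0 := by exact_mod_cast hN.ne'
  have hmem : ∀ c : Fin N → ℂ, MemLp (fun x => ∑ i, c i * cellFun N i x) 2 volume := fun c =>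
    memLp_finsetSum _ fun i _ => (memLp_cellFun i).const_mul (c i)
  have heig : ∀ c : Fin N → ℂ, c ∈ eigenspace
      (Matrix.toLin' ((matrixZ N).map (fun a : ℝ => (a : ℂ)))) (((N : ℝ) / l : ℝ) : ℂ) ↔
      ∀ i, c i = l * ∑ j, (matrixZ N i j : ℂ) * ((N : ℂ)⁻¹ * c j) := by
    intro c
    rw [mem_eigenspace_iff, funext_iff]
    refine forall_congr' fun i => ?_
    have h1 : l * ∑ j, (matrixZ N i j : ℂ) * ((N : ℂ)⁻¹ * c j)
        = l * (N : ℂ)⁻¹ * ∑ j, (matrixZ N i j : ℂ) * c j := by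
      rw [mul_assoc, Finset.mul_sum (Finset.univ) _ ((N : ℂ)⁻¹)]
      congr 1
      exact Finset.sum_congr rfl fun j _ => by ring
    rw [h1, Matrix.toLin'_apply, Matrix.mulVec, dotProduct]
    simp only [Matrix.map_apply, Pi.smul_apply, smul_eq_mul]
    push_cast
    constructor
    · intro h; rw [h]; field_simp
    · intro h; rw [h]; field_simp
  let Ψ : eigenspace (Matrix.toLin' ((matrixZ N).map (fun a : ℝ => (a : ℂ))))
      (((N : ℝ) / l : ℝ) : ℂ) →ₗ[ℂ] kernelEigenspace (stepKernel N) l :=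
    { toFun := fun c => ⟨fun x => ∑ i, c.1 i * cellFun N i x, hmem c.1, fun x =>
        ⟨isUnitKernel_stepKernel.integrable_mul (hmem c.1) x, by
          have h1 := kernelIntegral_stepKernel hN (hmem c.1) x
          rw [kernelIntegral] at h1
          rw [h1, Finset.mul_sum]
          refine Finset.sum_congr rfl fun i _ => ?_
          simp only [integral_cellFun_mul_sum hN]
          rw [← mul_assoc, ← (heig c.1).1 c.2 i]⟩⟩
      map_add' := fun c d => by
        apply Subtype.ext
        ext x
        simp [add_mul, Finset.sum_add_distrib]
      map_smul' := fun a c => by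
        apply Subtype.ext
        ext x
        simp [mul_assoc, Finset.mul_sum] }
  refine (LinearEquiv.finrank_eq (LinearEquiv.ofBijective Ψ ⟨?_, ?_⟩)).symm
  · rw [← LinearMap.ker_eq_bot, LinearMap.ker_eq_bot']
    intro c hc
    apply Subtype.ext
    ext i
    have hNr : (0 : ℝ) < N := by exact_mod_cast hN
    have hxI : ((i : ℕ) + 1 : ℝ) / N ∈ Set.Icc (0 : ℝ) 1 :=
      ⟨by positivity, by rw [div_le_one hNr]; exact_mod_cast i.2⟩
    -- Evaluation at the right endpoint, which belongs to the cell, recovers `c i`.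
    have hx : ((⟨((i : ℕ) + 1 : ℝ) / N, hxI⟩ : unitInterval) : ℝ) ∈ cell N i :=
      ⟨by simp only; gcongr; linarith, le_rfl⟩
    have h1 : ∑ j, c.1 j * cellFun N j ⟨((i : ℕ) + 1 : ℝ) / N, hxI⟩ = 0 :=
      congrFun (congrArg Subtype.val hc) _
    simpa [cellFun_of_mem hN hx] using h1
  · rintro ⟨φ, hφ⟩
    let c : Fin N → ℂ := fun i => l * ∑ j, (matrixZ N i j : ℂ) * ∫ y, cellFun N j y * φ y
    -- The eigenvalue equation itself forces `φ` to be a step function at every point.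
    have hφc : φ = fun x => ∑ i, c i * cellFun N i x := by
      ext x
      rw [(hφ.2 x).2]
      change l * kernelIntegral (stepKernel N) φ x = _
      rw [kernelIntegral_stepKernel hN hφ.1, Finset.mul_sum]
      exact Finset.sum_congr rfl fun i _ => (mul_assoc _ _ _).symm
    refine ⟨⟨c, (heig c).2 fun i => ?_⟩, Subtype.ext hφc.symm⟩
    have hint : ∀ j, ∫ y, cellFun N j y * φ y = (N : ℂ)⁻¹ * c j := fun j => by
      conv_lhs => rw [hφc]
      exact integral_cellFun_mul_sum hN c j
    simp only [← hint]
    rfl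

end

/-! ### Negative eigenvalues, attained infima, and the final estimates. -/

section

section Negation

variable (k : ℝ → ℝ → ℝ)

lemma kernelEigenspace_neg (l : ℝ) :
    kernelEigenspace (fun x y => -k x y) l = kernelEigenspace k (-l) := by
  ext φ
  change (MemLp φ 2 volume ∧ ∀ x : unitInterval,
    Integrable (fun y : unitInterval => ((-k x y : ℝ) : ℂ) * φ y) volume ∧
      φ x = (l : ℂ) * ∫ y : unitInterval, ((-k x y : ℝ) : ℂ) * φ y) ↔
    (MemLp φ 2 volume ∧ ∀ x : unitInterval,
    Integrable (fun y : unitInterval => (k x y : ℂ) * φ y) volume ∧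
      φ x = ((-l : ℝ) : ℂ) * ∫ y : unitInterval, (k x y : ℂ) * φ y)
  simp only [Complex.ofReal_neg, neg_mul, integral_neg, mul_neg, integrable_fun_neg_iff]

lemma index_neg (l : ℝ) : index (fun x y => -k x y) l = index k (-l) := by
  rw [index, index, kernelEigenspace_neg]

lemma eigenvalueCount_neg (S : Set ℝ) :
    eigenvalueCount (fun x y => -k x y) S = eigenvalueCount k (-S) := by
  have hinj : Function.Injective fun p : ℝ × ℕ => (-p.1, p.2) := fun p q h => by
    simp only [Prod.mk.injEq, neg_inj] at h
    exact Prod.ext h.1 h.2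
  rw [eigenvalueCount, eigenvalueCount, ← hinj.encard_image]
  congr 1
  ext ⟨l, i⟩
  simp only [index_neg, Set.mem_image, Set.mem_ofPred_eq, Prod.mk.injEq, Prod.exists, Set.mem_neg]
  constructor
  · rintro ⟨a, b, ⟨h1, h2⟩, rfl, rfl⟩
    exact ⟨by rwa [neg_neg], h2⟩
  · rintro ⟨h1, h2⟩
    exact ⟨-l, i, ⟨h1, by rwa [neg_neg]⟩, neg_neg l, rfl⟩

lemma nuNeg_eq_neg_nuPos (j : ℕ) : nuNeg k j = -nuPos (fun x y => -k x y) j := by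
  unfold nuNeg nuPos
  have h1 : eigenvalueCount (fun x y => -k x y) (Set.Ioi 0) = eigenvalueCount k (Set.Iio 0) := by
    rw [eigenvalueCount_neg, Set.neg_Ioi, neg_zero]
  rw [h1]
  split_ifs with hc
  · rw [Real.sInf_def, ← one_div_neg_eq_neg_one_div, neg_neg]
    congr 2
    ext t
    simp only [Set.mem_neg, Set.mem_ofPred_eq, eigenvalueCount_neg, Set.neg_Ioc, neg_neg, neg_zero,
      neg_pos]
  · rw [neg_zero]

end Negation

/-- If `k` has only finitely many positive eigenvalues, a nonzero `ν_{j+}` is the reciprocal of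
one of them. -/
lemma exists_eq_inv_of_nuPos_ne_zero {k : ℝ → ℝ → ℝ} {j : ℕ} (hj : 1 ≤ j)
    (hfin : {l : ℝ | 0 < l ∧ 0 < index k l}.Finite) (h : nuPos k j ≠ 0) :
    ∃ l : ℝ, 0 < l ∧ 0 < index k l ∧ nuPos k j = l⁻¹ := by
  set A := {t : ℝ | 0 < t ∧ (j : ℕ∞) ≤ eigenvalueCount k (Set.Ioc 0 t)} with hA
  have hnu : nuPos k j = 1 / sInf A := by
    unfold nuPos at h ⊢
    split_ifs at h ⊢ with hc
    · rfl
    · exact absurd rfl h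
  set Λ := {l : ℝ | 0 < l ∧ 0 < index k l} with hΛ
  -- Lowering `t` to the largest eigenvalue not exceeding it leaves the count unchanged, so the
  -- infimum of `A` is attained at an eigenvalue.
  have hstep : ∀ t ∈ A, ∃ l ∈ A ∩ Λ, l ≤ t := by
    intro t ht
    have hne : (Λ ∩ Set.Iic t).Nonempty := by
      have h1 : (1 : ℕ∞) ≤ eigenvalueCount k (Set.Ioc 0 t) := le_trans (by exact_mod_cast hj) ht.2
      rw [eigenvalueCount, Set.one_le_encard_iff_nonempty] at h1
      obtain ⟨p, hp1, hp2⟩ := h1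
      exact ⟨p.1, ⟨hp1.1, (Nat.zero_le _).trans_lt hp2⟩, hp1.2⟩
    obtain ⟨l, hl, hmax⟩ := (hfin.inter_of_left (Set.Iic t)).exists_maximal hne
    refine ⟨l, ⟨⟨hl.1.1, ht.2.trans (Set.encard_le_encard ?_)⟩, hl.1⟩, hl.2⟩
    rintro p ⟨hp1, hp2⟩
    refine ⟨⟨hp1.1, ?_⟩, hp2⟩
    have hp : p.1 ∈ Λ ∩ Set.Iic t := ⟨⟨hp1.1, (Nat.zero_le _).trans_lt hp2⟩, hp1.2⟩
    exact (le_total p.1 l).elim id fun h => hmax hp h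
  have hAne : A.Nonempty := by
    by_contra hne
    rw [Set.not_nonempty_iff_eq_empty.1 hne, Real.sInf_empty, div_zero] at hnu
    exact h hnu
  have hALne : (A ∩ Λ).Nonempty := by
    obtain ⟨t, ht⟩ := hAne
    obtain ⟨l, hl, -⟩ := hstep t ht
    exact ⟨l, hl⟩
  obtain ⟨l, hl, hmin⟩ := (hfin.inter_of_right A).exists_minimal hALne
  have hleast : IsLeast A l := ⟨hl.1, fun t ht => by
    obtain ⟨l', hl', hle⟩ := hstep t ht
    exact ((le_total l l').elim id fun h => hmin hl' h).trans hle⟩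
  exact ⟨l, hl.2.1, hl.2.2, by rw [hnu, hleast.csInf_eq, one_div]⟩

/-- Real and imaginary parts of a complex eigenvector satisfy the same real equation, and one of
them is nonzero. -/
lemma hasEigenvalue_of_map_ofReal {n : Type*} [Fintype n] [DecidableEq n] {M : Matrix n n ℝ} {μ : ℝ}
    (h : HasEigenvalue (Matrix.toLin' (M.map (fun a : ℝ => (a : ℂ)))) (μ : ℂ)) :
    HasEigenvalue (Matrix.toLin' M) μ := by
  obtain ⟨v, hv, hv0⟩ := h.exists_hasEigenvector
  rw [mem_eigenspace_iff, Matrix.toLin'_apply] at hv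
  have hre : (fun i => (v i).re) ∈ eigenspace (Matrix.toLin' M) μ := by
    rw [mem_eigenspace_iff, Matrix.toLin'_apply]
    ext i
    have := congrArg Complex.re (congrFun hv i)
    simpa [Matrix.mulVec, dotProduct] using this
  have him : (fun i => (v i).im) ∈ eigenspace (Matrix.toLin' M) μ := by
    rw [mem_eigenspace_iff, Matrix.toLin'_apply]
    ext i
    have := congrArg Complex.im (congrFun hv i)
    simpa [Matrix.mulVec, dotProduct] using this
  by_cases h0 : (fun i => (v i).re) = 0
  · refine hasEigenvalue_of_hasEigenvector ⟨him, fun h1 => hv0 ?_⟩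
    ext i
    exact Complex.ext (congrFun h0 i) (congrFun h1 i)
  · exact hasEigenvalue_of_hasEigenvector ⟨hre, h0⟩

variable {N : ℕ}

lemma hasEigenvalue_matrixZ_of_index_pos (hN : 0 < N) {l : ℝ} (hl : l ≠ 0)
    (h : 0 < index (stepKernel N) l) :
    HasEigenvalue (Matrix.toLin' (matrixZ N)) ((N : ℝ) / l) := by
  apply hasEigenvalue_of_map_ofReal
  rw [index_stepKernel hN hl] at h
  intro (hbot : eigenspace _ _ = ⊥)
  rw [hbot] at h
  simp at h

lemma finite_eigenvalues_stepKernel (hN : 0 < N) :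
    {l : ℝ | l ≠ 0 ∧ 0 < index (stepKernel N) l}.Finite := by
  refine Set.Finite.of_finite_image (f := fun l : ℝ => (N : ℝ) / l)
    ((finite_hasEigenvalue (Matrix.toLin' (matrixZ N))).subset ?_) ?_
  · rintro _ ⟨l, hl, rfl⟩
    exact hasEigenvalue_matrixZ_of_index_pos hN hl.1 hl.2
  · intro a ha b hb hab
    have hN' : (N : ℝ) ≠ 0 := by exact_mod_cast hN.ne'
    have ha0 : a ≠ 0 := ha.1
    have hb0 : b ≠ 0 := hb.1
    simp only at hab
    field_simp at hab
    exact hab.symm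

lemma exists_nuPos_stepKernel_eq (hN : 0 < N) {j : ℕ} (hj : 1 ≤ j) (h : nuPos (stepKernel N) j ≠ 0) :
    ∃ L : ℝ, HasEigenvalue (Matrix.toLin' (matrixZ N)) L
      ∧ nuPos (stepKernel N) j = (N : ℝ)⁻¹ * L := by
  have hN' : (N : ℝ) ≠ 0 := by exact_mod_cast hN.ne'
  obtain ⟨l, hl0, hl, he⟩ := exists_eq_inv_of_nuPos_ne_zero hj
    ((finite_eigenvalues_stepKernel hN).subset fun l hl => ⟨hl.1.ne', hl.2⟩) h
  refine ⟨_, hasEigenvalue_matrixZ_of_index_pos hN hl0.ne' hl, ?_⟩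
  rw [he]
  field_simp

lemma exists_nuNeg_stepKernel_eq (hN : 0 < N) {j : ℕ} (hj : 1 ≤ j) (h : nuNeg (stepKernel N) j ≠ 0) :
    ∃ L : ℝ, HasEigenvalue (Matrix.toLin' (matrixZ N)) L
      ∧ nuNeg (stepKernel N) j = (N : ℝ)⁻¹ * L := by
  have hN' : (N : ℝ) ≠ 0 := by exact_mod_cast hN.ne'
  rw [nuNeg_eq_neg_nuPos, neg_ne_zero] at h
  have hfin : {l : ℝ | 0 < l ∧ 0 < index (fun x y => -stepKernel N x y) l}.Finite := by
    refine ((finite_eigenvalues_stepKernel hN).image Neg.neg).subset fun l hl => ?_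
    refine ⟨-l, ⟨neg_ne_zero.2 hl.1.ne', ?_⟩, neg_neg l⟩
    rw [← index_neg]
    exact hl.2
  obtain ⟨l, hl0, hl, he⟩ := exists_eq_inv_of_nuPos_ne_zero hj hfin h
  rw [index_neg] at hl
  refine ⟨_, hasEigenvalue_matrixZ_of_index_pos hN (neg_ne_zero.2 hl0.ne') hl, ?_⟩
  rw [nuNeg_eq_neg_nuPos, he]
  field_simp

namespace IsUnitKernel

variable {k k' : ℝ → ℝ → ℝ}

lemma neg (hk : IsUnitKernel k) : IsUnitKernel fun x y => -k x y :=
  ⟨hk.measurable.neg, fun x y => by rw [abs_neg]; exact hk.abs_le_one x y⟩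

lemma op_neg (hk : IsUnitKernel k) : hk.neg.op = -hk.op := by
  ext1 f
  rw [_root_.neg_apply, op_apply, op_apply, ← MemLp.toLp_neg]
  congr 1
  ext x
  simp only [kernelIntegral, Pi.neg_apply, Complex.ofReal_neg, neg_mul, integral_neg]

lemma abs_nuPos_sub_le (hk : IsUnitKernel k) (hk' : IsUnitKernel k')
    (hsymm : ∀ x y, k x y = k y x) (hsymm' : ∀ x y, k' x y = k' y x)
    (hc : IsCompactOperator hk.op) (hc' : IsCompactOperator hk'.op) {ε : ℝ}
    (hε : ‖hk.op - hk'.op‖ ≤ ε) {j : ℕ} (hj : 1 ≤ j) : |nuPos k j - nuPos k' j| ≤ ε := by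
  have hS := hk.isSymmetric_op hsymm
  have hS' := hk'.isSymmetric_op hsymm'
  have h1 := nuPos_le_add hS (fun l hl => hk.index_eq hl.ne') hc' hS'
    (fun l hl => hk'.index_eq hl.ne') hj hε
  have h2 := nuPos_le_add hS' (fun l hl => hk'.index_eq hl.ne') hc hS
    (fun l hl => hk.index_eq hl.ne') hj ((norm_sub_rev _ _).trans_le hε)
  rw [abs_sub_le_iff]
  constructor <;> linarith

lemma abs_nuNeg_sub_le (hk : IsUnitKernel k) (hk' : IsUnitKernel k')
    (hsymm : ∀ x y, k x y = k y x) (hsymm' : ∀ x y, k' x y = k' y x)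
    (hc : IsCompactOperator hk.op) (hc' : IsCompactOperator hk'.op) {ε : ℝ}
    (hε : ‖hk.op - hk'.op‖ ≤ ε) {j : ℕ} (hj : 1 ≤ j) : |nuNeg k j - nuNeg k' j| ≤ ε := by
  rw [nuNeg_eq_neg_nuPos, nuNeg_eq_neg_nuPos, neg_sub_neg, abs_sub_comm]
  refine hk.neg.abs_nuPos_sub_le hk'.neg (fun x y => by rw [hsymm]) (fun x y => by rw [hsymm'])
    ?_ ?_ ?_ hj
  · rw [op_neg]; exact hc.neg
  · rw [op_neg]; exact hc'.neg
  · rw [op_neg, op_neg, neg_sub_neg, norm_sub_rev]; exact hε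

end IsUnitKernel

lemma sqrt_hsBound_lt (hN : 25 ≤ N) :
    √(hsBound N) < √(bracket N) * (N : ℝ) ^ (-(1 / 4) : ℝ) := by
  have h : (0 : ℝ) < N := by exact_mod_cast (by omega : 0 < N)
  have hpow : (N : ℝ) ^ (-(1 / 4) : ℝ) = √(1 / √(N : ℝ)) := by
    rw [Real.sqrt_eq_rpow, Real.sqrt_eq_rpow, one_div ((N : ℝ) ^ (1 / 2 : ℝ)), ← Real.rpow_neg h.le,
      ← Real.rpow_mul h.le]
    norm_num
  have hb : 0 < bracket N := by
    have h1 := one_lt_sqrt_log hN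
    have h2 : 0 ≤ Real.log (Real.log N) := Real.log_nonneg (by linarith [three_lt_log hN])
    unfold bracket
    positivity
  rw [hpow, ← Real.sqrt_mul hb.le, mul_one_div]
  have hr : 0 < √(N : ℝ) := Real.sqrt_pos.2 h
  exact (Real.sqrt_lt_sqrt_iff_of_pos (by positivity)).2 (hsBound_lt hN)

end

end WattKernel


theorem theorem2 (m N : ℕ) (hm : 1 ≤ m) (hN : 25 ≤ N) :
    (|WattKernel.nuPos WattKernel.kernelK m - WattKernel.nuPos (WattKernel.stepKernel N) m|
        < √(WattKernel.bracket N) * (N : ℝ) ^ (-(1 / 4) : ℝ)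
      ∧ |WattKernel.nuNeg WattKernel.kernelK m - WattKernel.nuNeg (WattKernel.stepKernel N) m|
        < √(WattKernel.bracket N) * (N : ℝ) ^ (-(1 / 4) : ℝ))
    ∧ (WattKernel.nuPos (WattKernel.stepKernel N) m ≠ 0 →
        ∃ L : ℝ, Module.End.HasEigenvalue (Matrix.toLin' (WattKernel.matrixZ N)) L
          ∧ WattKernel.nuPos (WattKernel.stepKernel N) m = (N : ℝ)⁻¹ * L)
    ∧ (WattKernel.nuNeg (WattKernel.stepKernel N) m ≠ 0 →
        ∃ L : ℝ, Module.End.HasEigenvalue (Matrix.toLin' (WattKernel.matrixZ N)) L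
          ∧ WattKernel.nuNeg (WattKernel.stepKernel N) m = (N : ℝ)⁻¹ * L)
    ∧ (∀ l : ℝ, l ≠ 0 →
        WattKernel.index (WattKernel.stepKernel N) l
          = Module.finrank ℂ (Module.End.eigenspace
              (Matrix.toLin' ((WattKernel.matrixZ N).map (fun a : ℝ => (a : ℂ))))
              (((N : ℝ) / l : ℝ) : ℂ))) := by
  have hN0 : 0 < N := by omega
  have hlt := WattKernel.sqrt_hsBound_lt hN
  have hnorm := WattKernel.norm_op_sub_le hN
  have hc := WattKernel.isCompactOperator_op_kernelK
  have hc' := WattKernel.isCompactOperator_op_stepKernel hN0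
  exact ⟨⟨(WattKernel.IsUnitKernel.abs_nuPos_sub_le _ _ WattKernel.kernelK_comm
      WattKernel.stepKernel_comm hc hc' hnorm hm).trans_lt hlt,
    (WattKernel.IsUnitKernel.abs_nuNeg_sub_le _ _ WattKernel.kernelK_comm
      WattKernel.stepKernel_comm hc hc' hnorm hm).trans_lt hlt⟩,
    WattKernel.exists_nuPos_stepKernel_eq hN0 hm, WattKernel.exists_nuNeg_stepKernel_eq hN0 hm,
    fun l hl => WattKernel.index_stepKernel hN0 hl⟩
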